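/- Let $\ell,\mu,\rho>0$ and let $f:\mathbb{R}^n\times\mathbb{R}^m\to\mathbb{R}$ ($m\ge 1$) be twice continuously differentiable and $\mu$-strongly concave in $y$ for every $x$ (possibly nonconvex in $x$). Assume that $\nabla f$ is $\ell$-Lipschitz, that the blocks $\nabla^2_{xx}f,\nabla^2_{xy}f,\nabla^2_{yx}f,\nabla^2_{yy}f$ are $\rho$-Lipschitz, and that $P(x)=\max_y f(x,y)$ is bounded below by a constant $P^*$. Write $y^*(x)=\arg\max_y f(x,y)$, $H=\nabla^2_{xx}f-\nabla^2_{xy}f(\nabla^2_{yy}f)^{-1}\nabla^2_{yx}f$, and put $$\kappa=\frac{\ell}{\mu},\quad L_1=(\kappa+1)\ell,\quad L_H=\rho(1+\kappa)^2,\quad L_2=\rho(1+\kappa)^3,\quad \sigma=\frac{\sqrt{L_2}}{2},\quad r=\frac{1}{4\sqrt{L_2}},\quad \eta=\frac{2}{\ell+\mu}.$$ For $0<\epsilon\le 1$ let $$\epsilon_1=\min\Big\{\frac1{96},\frac{\sqrt{L_2}}{16L_1}\Big\}\epsilon^{3/2},\qquad \epsilon_2=\frac{\sqrt{L_2}}{12}\epsilon^{1/2},\qquad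 A=\min\Big\{\frac{\epsilon_1}{\ell},\frac{\epsilon_2}{L_H}\Big\}.$$ The GRTR algorithm starts from $x_1=x_0$ and $y_0$. In iteration $t\ge1$ it obtains $y_t$ from $y_{t-1}$ by $N_t$ gradient ascent steps $y\leftarrow y+\eta\nabla_y f(x_t,y)$, sets $g_t=\nabla_x f(x_t,y_t)$ and $H_t=H(x_t,y_t)$, takes for $s_t$ a global solution of $$\min_{\|s\|\le r\max\{\|g_t\|^{1/2},\epsilon^{1/2}\}}\ g_t^\top s+\tfrac12 s^\top\big(H_t+\sigma\|g_t\|^{1/2}I\big)s,$$ and sets $x_{t+1}=x_t+s_t$. Assume $N_1\ge\kappa\log\frac{\|y_0-y^*(x_0)\|}{A}$ and $N_t\ge\kappa\log\frac{A+\kappa\|s_{t-1}\|}{A}$ for $t\ge2$. Let $\Delta=P(x_0)-P^*$, $C=(128\sqrt{L_2}\,\Delta)^{2/3}$ and $$G=\max\Big\{2+\frac{L_1}{4\sqrt{L_2}}C^{1/2}+C,\ 2+\frac{L_1}{4\sqrt{L_2}}\Big\}.$$ For $\xi,\theta>0$ let $T(\epsilon)$ be the first index $t\ge1$ with $\|\nabla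 P(x_t)\|\le\xi\epsilon$ and $\nabla^2P(x_t)\succeq-\theta\sqrt{\epsilon}\,I$, that is, the first index at which $x_t$ is an $\mathcal{O}(\epsilon,\sqrt\epsilon)$-second-order stationary point of $P$. Then there are positive constants $\xi,\theta$ that do not depend on $\epsilon$ (they depend only on $\ell,\mu,\rho,\Delta$) such that for every $\epsilon\in(0,1]$ and every run of the algorithm, $T(\epsilon)$ exists and $$T(\epsilon)\le128\Big(\Big\lceil\frac{\log(G/\epsilon)}{\log3}\Big\rceil+1\Big)\sqrt{L_2}\,(P(x_0)-P^*)\,\epsilon^{-3/2}+1 .$$ Consequently $$T(\epsilon)\le256\sqrt2\Big(\Big\lceil\frac{\log(G/\epsilon)}{\log3}\Big\rceil+1\Big)\rho^{1/2}\kappa^{3/2}\epsilon^{-3/2}(P(x_0)-P^*)+1,$$ that is, the iteration complexity is $\tilde{\mathcal{O}}(\rho^{0.5}\kappa^{1.5}\epsilon^{-3/2})$. Moreover, there is $\bar\epsilon>0$ depending only on $\ell,\mu,\rho,\Delta$ such that for $\epsilon\le\bar\epsilon$ both bounds hold with the explicit constants $\xi=\frac{97}{96}$ and $\theta=\frac{19}{12}\sqrt{L_2}$.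 -/

import Mathlib

/-! Nonconvex-strongly concave minimax problems and the gradient norm regularized
trust region (GRTR) method. -/

namespace GRTR

open Set

/-- The space `ℝ^n` with its Euclidean norm. -/
abbrev Rn (n : ℕ) : Type := EuclideanSpace ℝ (Fin n)

noncomputable section

section Calculus

variable {n m : ℕ}

/-- Euclidean norm of the pair `(a, b)` in `ℝ^n × ℝ^m`. -/
def pairNorm (a : Rn n) (b : Rn m) : ℝ := √(‖a‖ ^ 2 + ‖b‖ ^ 2)

/-- `∇_x f (x, y)`. -/
def gradX (f : Rn n → Rn m → ℝ) (x : Rn n) (y : Rn m) : Rn n :=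
  gradient (fun x' => f x' y) x

/-- `∇_y f (x, y)`. -/
def gradY (f : Rn n → Rn m → ℝ) (x : Rn n) (y : Rn m) : Rn m :=
  gradient (fun y' => f x y') y

/-- `∇²_xx f (x, y)`. -/
def hessXX (f : Rn n → Rn m → ℝ) (x : Rn n) (y : Rn m) : Rn n →L[ℝ] Rn n :=
  fderiv ℝ (fun x' => gradX f x' y) x

/-- `∇²_xy f (x, y)`, the Jacobian in `y` of `∇_x f`. -/
def hessXY (f : Rn n → Rn m → ℝ) (x : Rn n) (y : Rn m) : Rn m →L[ℝ] Rn n :=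
  fderiv ℝ (fun y' => gradX f x y') y

/-- `∇²_yx f (x, y)`, the Jacobian in `x` of `∇_y f`. -/
def hessYX (f : Rn n → Rn m → ℝ) (x : Rn n) (y : Rn m) : Rn n →L[ℝ] Rn m :=
  fderiv ℝ (fun x' => gradY f x' y) x

/-- `∇²_yy f (x, y)`. -/
def hessYY (f : Rn n → Rn m → ℝ) (x : Rn n) (y : Rn m) : Rn m →L[ℝ] Rn m :=
  fderiv ℝ (fun y' => gradY f x y') y

/-- `H = ∇²_xx f - ∇²_xy f (∇²_yy f)⁻¹ ∇²_yx f` at `(x, y)`. The inverse is the genuine one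
whenever `f x` is strongly concave and `C²`. -/
def schurH (f : Rn n → Rn m → ℝ) (x : Rn n) (y : Rn m) : Rn n →L[ℝ] Rn n :=
  hessXX f x y - (hessXY f x y).comp ((hessYY f x y).inverse.comp (hessYX f x y))

/-- `P x = max_y f (x, y)`. -/
def primal (f : Rn n → Rn m → ℝ) (x : Rn n) : ℝ := ⨆ y, f x y

/-- `y*(x) = argmax_y f (x, y)`. -/
def yStar (f : Rn n → Rn m → ℝ) (x : Rn n) : Rn m :=
  Classical.epsilon fun y => IsMaxOn (f x) univ y

/-- The standing assumptions on `f`: twice continuously differentiable, `μ`-strongly concave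
in `y`, `ℓ`-Lipschitz gradient, `ρ`-Lipschitz second derivative blocks (Euclidean norm on
`ℝ^n × ℝ^m`, operator norm on matrices), and `max_y f (·, y)` bounded below by `Pstar`. -/
structure Assumptions (f : Rn n → Rn m → ℝ) (ℓ μ ρ Pstar : ℝ) : Prop where
  contDiff : ContDiff ℝ 2 (fun p : Rn n × Rn m => f p.1 p.2)
  strongConcave : ∀ x, StrongConcaveOn univ μ (f x)
  grad_lipschitz : ∀ x y x' y',
    pairNorm (gradX f x y - gradX f x' y') (gradY f x y - gradY f x' y')
      ≤ ℓ * pairNorm (x - x') (y - y')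
  hessXX_lipschitz : ∀ x y x' y',
    ‖hessXX f x y - hessXX f x' y'‖ ≤ ρ * pairNorm (x - x') (y - y')
  hessXY_lipschitz : ∀ x y x' y',
    ‖hessXY f x y - hessXY f x' y'‖ ≤ ρ * pairNorm (x - x') (y - y')
  hessYX_lipschitz : ∀ x y x' y',
    ‖hessYX f x y - hessYX f x' y'‖ ≤ ρ * pairNorm (x - x') (y - y')
  hessYY_lipschitz : ∀ x y x' y',
    ‖hessYY f x y - hessYY f x' y'‖ ≤ ρ * pairNorm (x - x') (y - y')
  lower_bound : ∀ x, Pstar ≤ primal f x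

/-- `x` is a second-order stationary point of `P` at accuracy `(ξ ε, θ √ε)`:
`P` is twice differentiable at `x`, `‖∇P(x)‖ ≤ ξ ε` and `∇²P(x) ⪰ -θ √ε I`. -/
def IsSOSP (P : Rn n → ℝ) (ξ θ ε : ℝ) (x : Rn n) : Prop :=
  (∀ᶠ x' in nhds x, DifferentiableAt ℝ P x') ∧ DifferentiableAt ℝ (gradient P) x ∧
    ‖gradient P x‖ ≤ ξ * ε ∧
    ∀ v : Rn n, -(θ * √ε) * ‖v‖ ^ 2 ≤ inner ℝ v (fderiv ℝ (gradient P) x v)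

/-- `T` is the first iteration index `t ≥ 1` at which `x t` is such a point. -/
def IsFirstIndex (P : Rn n → ℝ) (x : ℕ → Rn n) (ξ θ ε : ℝ) (T : ℕ) : Prop :=
  IsLeast {t : ℕ | 1 ≤ t ∧ IsSOSP P ξ θ ε (x t)} T

end Calculus

section Constants

/-- Condition number `κ = ℓ / μ`. -/
def kappa (ℓ μ : ℝ) : ℝ := ℓ / μ

/-- `L₁ = (κ + 1) ℓ`. -/
def L1 (ℓ μ : ℝ) : ℝ := (kappa ℓ μ + 1) * ℓ

/-- `L_H = ρ (1 + κ)²`. -/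
def LH (ℓ μ ρ : ℝ) : ℝ := ρ * (1 + kappa ℓ μ) ^ 2

/-- `L₂ = ρ (1 + κ)³`. -/
def L2 (ℓ μ ρ : ℝ) : ℝ := ρ * (1 + kappa ℓ μ) ^ 3

/-- `ε₁ = min {1/96, √L₂ / (16 L₁)} ε^{3/2}`. -/
def eps1 (ℓ μ ρ ε : ℝ) : ℝ :=
  min (1 / 96) (√(L2 ℓ μ ρ) / (16 * L1 ℓ μ)) * ε ^ (3 / 2 : ℝ)

/-- `ε₂ = √L₂ / 12 ε^{1/2}`. -/
def eps2 (ℓ μ ρ ε : ℝ) : ℝ := √(L2 ℓ μ ρ) / 12 * √ε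

/-- `A = min {ε₁ / ℓ, ε₂ / L_H}`. -/
def accA (ℓ μ ρ ε : ℝ) : ℝ := min (eps1 ℓ μ ρ ε / ℓ) (eps2 ℓ μ ρ ε / LH ℓ μ ρ)

/-- `C = (128 √L₂ Δ)^{2/3}`, where `Δ` stands for `P(x₀) - P*`. -/
def constC (ℓ μ ρ Δ : ℝ) : ℝ := (128 * √(L2 ℓ μ ρ) * Δ) ^ (2 / 3 : ℝ)

/-- `G = max {2 + L₁ / (4 √L₂) C^{1/2} + C, 2 + L₁ / (4 √L₂)}`. -/
def constG (ℓ μ ρ Δ : ℝ) : ℝ :=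
  max (2 + L1 ℓ μ / (4 * √(L2 ℓ μ ρ)) * √(constC ℓ μ ρ Δ) + constC ℓ μ ρ Δ)
    (2 + L1 ℓ μ / (4 * √(L2 ℓ μ ρ)))

/-- The logarithmic factor `⌈log (G / ε) / log 3⌉ + 1`. -/
def logFactor (ℓ μ ρ Δ ε : ℝ) : ℝ :=
  (⌈Real.log (constG ℓ μ ρ Δ / ε) / Real.log 3⌉ : ℝ) + 1

end Constants

section Algorithm

variable {n m : ℕ}

/-- Objective of the trust region subproblem:
`gᵀ s + ½ sᵀ (H + σ ‖g‖^{1/2} I) s`. -/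
def model (g : Rn n) (H : Rn n →L[ℝ] Rn n) (σ : ℝ) (s : Rn n) : ℝ :=
  inner ℝ g s + 1 / 2 * inner ℝ s (H s + (σ * √‖g‖) • s)

/-- `(x t, y t, s t)`, `t ≥ 1`, is a run of the GRTR algorithm from `(x₀, y₀)` with step size
`η`, parameters `σ, r, ε` and inner loop counts `N t`. (`y 0 = y₀`; the values `x 0`, `s 0`,
`N 0` are not used.) In each iteration any global solution of the subproblem may be taken. -/
structure IsRun (f : Rn n → Rn m → ℝ) (η σ r ε : ℝ) (N : ℕ → ℕ) (x₀ : Rn n) (y₀ : Rn m)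
    (x : ℕ → Rn n) (y : ℕ → Rn m) (s : ℕ → Rn n) : Prop where
  init_x : x 1 = x₀
  init_y : y 0 = y₀
  /-- `N t` gradient ascent steps in `y`, warm-started at `y (t - 1)` -/
  ascent : ∀ t, 1 ≤ t → y t = (fun z => z + η • gradY f (x t) z)^[N t] (y (t - 1))
  feasible : ∀ t, 1 ≤ t → ‖s t‖ ≤ r * max (√‖gradX f (x t) (y t)‖) (√ε)
  optimal : ∀ t, 1 ≤ t → ∀ s' : Rn n, ‖s'‖ ≤ r * max (√‖gradX f (x t) (y t)‖) (√ε) →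
    model (gradX f (x t) (y t)) (schurH f (x t) (y t)) σ (s t)
      ≤ model (gradX f (x t) (y t)) (schurH f (x t) (y t)) σ s'
  update : ∀ t, 1 ≤ t → x (t + 1) = x t + s t

/-- The inner loop counts are large enough: `N₁ ≥ κ log (‖y₀ - y*(x₀)‖ / A)` and
`N_t ≥ κ log ((A + κ ‖s_{t-1}‖) / A)` for `t ≥ 2`. -/
def EnoughInnerSteps (f : Rn n → Rn m → ℝ) (κ A : ℝ) (x₀ : Rn n) (y₀ : Rn m)
    (s : ℕ → Rn n) (N : ℕ → ℕ) : Prop :=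
  κ * Real.log (‖y₀ - yStar f x₀‖ / A) ≤ N 1 ∧
    ∀ t, 2 ≤ t → κ * Real.log ((A + κ * ‖s (t - 1)‖) / A) ≤ N t

end Algorithm

end

end GRTR

/-! Strong concavity makes `yStar` single-valued, Lipschitz and differentiable, so `primal f` is
twice differentiable: its gradient is ∇_x f and its Hessian is the Schur complement `schurH`, both
at (x, y*(x)), with Lipschitz constants L₁ and L₂. Gradient ascent contracts by at least exp(-1/κ)
per step, so the prescribed loop counts keep y_t within A of y*(x_t) (`norm_sub_yStar_le_accA`). The
algorithm is thus a regularized trust region method on P with controlled errors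
(`inexactStep_of_isRun`).

At a non-stationary iterate `decrease_or_shrink` leaves two outcomes. If ‖g‖ ≤ ε, negative curvature
forces a large multiplier, hence a boundary step and a decrease of order ε^{3/2}/√L₂. If ‖g‖ > ε, a
boundary step decreases P as much, and an interior step solves a regularized Newton equation, so the
gradient drops by a factor above 3 while P does not grow. As P never exceeds P(x₀), inexact
gradients stay below G. Hence at most F = ⌈log(G/ε)/log 3⌉ shrinking steps occur in a row, and Δ
limits the number K of decreasing steps (`exists_count`).

The count gives (F+1)(K+1), including one unfinished block. That extra block is absorbed because for
ε ≤ 1/4 the decrease is 7/6 of the nominal ε^{3/2}/(128√L₂): with X = 128√L₂ Δ ε^{-3/2} this gives K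
≤ 6X/7, so K+1 ≤ X once X ≥ 7. `epsThreshold` encodes these two conditions when Δ > 0. If Δ = 0, x₀
minimizes P. For ε above the threshold, ξ and θ are chosen so large that x₀ itself is stationary. -/

namespace GRTR

open Set Filter Topology

/-! ### Taylor remainder for maps with Lipschitz derivative. -/

section Taylor

variable {E F : Type*} [NormedAddCommGroup E] [NormedSpace ℝ E] [NormedAddCommGroup F]
  [NormedSpace ℝ F]

theorem hasDerivAt_line (x s : E) (t : ℝ) : HasDerivAt (fun t : ℝ => x + t • s) s t := by
  simpa using ((hasDerivAt_id t).smul_const s).const_add x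

/-- Along the segment the remainder starts at 0 and its derivative is at most L‖s‖²t, so it is
dominated by the primitive L/2 ‖s‖²t². -/
theorem norm_sub_sub_fderiv_le {G : E → F} {G' : E → E →L[ℝ] F}
    (hG : ∀ x, HasFDerivAt G (G' x) x) {L : ℝ} (hL : ∀ x y, ‖G' x - G' y‖ ≤ L * ‖x - y‖)
    (x s : E) : ‖G (x + s) - G x - G' x s‖ ≤ L / 2 * ‖s‖ ^ 2 := by
  have hd : ∀ t : ℝ, HasDerivAt (fun t : ℝ => G (x + t • s) - G x - t • G' x s)
      (G' (x + t • s) s - G' x s) t := by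
    intro t
    have h1 := (hG (x + t • s)).comp_hasDerivAt t (hasDerivAt_line x s t)
    have h2 := (hasDerivAt_id t).smul_const (G' x s)
    exact ((h1.sub_const (G x)).sub h2).congr_deriv (by simp)
  have hB : ∀ t : ℝ, HasDerivAt (fun t : ℝ => L / 2 * ‖s‖ ^ 2 * t ^ 2) (L * ‖s‖ ^ 2 * t) t := by
    intro t
    refine ((hasDerivAt_pow 2 t).const_mul (L / 2 * ‖s‖ ^ 2)).congr_deriv ?_
    push_cast
    ring
  have key := image_norm_le_of_norm_deriv_right_le_deriv_boundary (a := 0) (b := 1)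
    (f := fun t : ℝ => G (x + t • s) - G x - t • G' x s)
    (fun t _ => (hd t).continuousAt.continuousWithinAt)
    (fun t _ => (hd t).hasDerivWithinAt) (by simp) hB (fun t ht => by
      rw [← _root_.sub_apply]
      calc ‖(G' (x + t • s) - G' x) s‖ ≤ ‖G' (x + t • s) - G' x‖ * ‖s‖ :=
            ContinuousLinearMap.le_opNorm _ _
        _ ≤ (L * ‖x + t • s - x‖) * ‖s‖ := by gcongr; exact hL _ _
        _ = L * ‖s‖ ^ 2 * t := by
            rw [add_sub_cancel_left, norm_smul, Real.norm_of_nonneg ht.1]; ring)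
    (right_mem_Icc.2 zero_le_one)
  simpa using key

end Taylor

/-! ### Taylor bounds for functions with a gradient, and symmetric operators. -/

section Inner

variable {E : Type*} [NormedAddCommGroup E] [InnerProductSpace ℝ E]

local notation "⟪" x ", " y "⟫" => inner ℝ x y

theorem abs_sub_linear_le {φ : E → ℝ} {G : E → E} (hφ : ∀ x, HasFDerivAt φ (innerSL ℝ (G x)) x)
    {L : ℝ} (hL : ∀ x y, ‖G x - G y‖ ≤ L * ‖x - y‖) (x s : E) :
    |φ (x + s) - φ x - ⟪G x, s⟫| ≤ L / 2 * ‖s‖ ^ 2 := by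
  have := norm_sub_sub_fderiv_le hφ (L := L) (fun x y => by
    rw [← map_sub, innerSL_apply_norm]; exact hL x y) x s
  simpa using this

/-- The derivative of the remainder along the segment is the first-order remainder of the gradient
paired with s, hence at most L/2 ‖s‖³t²; integrating gives the cubic bound. -/
theorem abs_sub_quadratic_le {φ : E → ℝ} {G : E → E} {G' : E → E →L[ℝ] E}
    (hφ : ∀ x, HasFDerivAt φ (innerSL ℝ (G x)) x) (hG : ∀ x, HasFDerivAt G (G' x) x)
    {L : ℝ} (hL : ∀ x y, ‖G' x - G' y‖ ≤ L * ‖x - y‖) (x s : E) :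
    |φ (x + s) - φ x - ⟪G x, s⟫ - 1 / 2 * ⟪s, G' x s⟫| ≤ L / 6 * ‖s‖ ^ 3 := by
  have hd : ∀ t : ℝ, HasDerivAt
      (fun t : ℝ => φ (x + t • s) - φ x - t * ⟪G x, s⟫ - t ^ 2 * (1 / 2 * ⟪s, G' x s⟫))
      (⟪G (x + t • s), s⟫ - ⟪G x, s⟫ - t * ⟪s, G' x s⟫) t := by
    intro t
    have h1 := (hφ (x + t • s)).comp_hasDerivAt t (hasDerivAt_line x s t)
    have h2 := (hasDerivAt_id t).mul_const ⟪G x, s⟫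
    have h3 := (hasDerivAt_pow 2 t).mul_const (1 / 2 * ⟪s, G' x s⟫)
    have h4 := ((h1.sub_const (φ x)).sub h2).sub h3
    refine h4.congr_deriv ?_
    simp
    ring
  have hB : ∀ t : ℝ, HasDerivAt (fun t : ℝ => L / 6 * ‖s‖ ^ 3 * t ^ 3)
      (L / 2 * ‖s‖ ^ 3 * t ^ 2) t := by
    intro t
    refine ((hasDerivAt_pow 3 t).const_mul (L / 6 * ‖s‖ ^ 3)).congr_deriv ?_
    push_cast
    ring
  have key := image_norm_le_of_norm_deriv_right_le_deriv_boundary (a := 0) (b := 1)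
    (f := fun t : ℝ => φ (x + t • s) - φ x - t * ⟪G x, s⟫ - t ^ 2 * (1 / 2 * ⟪s, G' x s⟫))
    (fun t _ => (hd t).continuousAt.continuousWithinAt)
    (fun t _ => (hd t).hasDerivWithinAt) (by simp) hB (fun t ht => by
      have e : ⟪G (x + t • s), s⟫ - ⟪G x, s⟫ - t * ⟪s, G' x s⟫
          = ⟪G (x + t • s) - G x - G' x (t • s), s⟫ := by
        rw [inner_sub_left, inner_sub_left, map_smul, real_inner_smul_left,
          real_inner_comm s (G' x s)]
      rw [e]
      calc ‖⟪G (x + t • s) - G x - G' x (t • s), s⟫‖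
          ≤ ‖G (x + t • s) - G x - G' x (t • s)‖ * ‖s‖ := norm_inner_le_norm _ _
        _ ≤ (L / 2 * ‖t • s‖ ^ 2) * ‖s‖ := by
            gcongr; exact norm_sub_sub_fderiv_le hG hL x (t • s)
        _ = L / 2 * ‖s‖ ^ 3 * t ^ 2 := by
            rw [norm_smul, Real.norm_of_nonneg ht.1]; ring)
    (right_mem_Icc.2 zero_le_one)
  simpa [Real.norm_eq_abs] using key

/-- A smooth function bounded below has small gradient at points of small value. -/
theorem norm_grad_sq_le {φ : E → ℝ} {G : E → E} (hφ : ∀ x, HasFDerivAt φ (innerSL ℝ (G x)) x)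
    {L : ℝ} (hL0 : 0 < L) (hL : ∀ x y, ‖G x - G y‖ ≤ L * ‖x - y‖) {m : ℝ} (hm : ∀ x, m ≤ φ x)
    (x : E) : ‖G x‖ ^ 2 ≤ 2 * L * (φ x - m) := by
  -- The step -G(x)/L minimizes the quadratic upper bound of φ around x.
  have h := (abs_le.1 (abs_sub_linear_le hφ hL x (-(1 / L) • G x))).2
  rw [real_inner_smul_right, real_inner_self_eq_norm_sq, norm_smul, mul_pow, Real.norm_eq_abs,
    sq_abs] at h
  have h2 := hm (x + -(1 / L) • G x)
  have h3 : 1 / (2 * L) * ‖G x‖ ^ 2 ≤ φ x - m := by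
    have e1 : L / 2 * ((-(1 / L)) ^ 2 * ‖G x‖ ^ 2) = 1 / (2 * L) * ‖G x‖ ^ 2 := by field_simp
    have e2 : -(1 / L) * ‖G x‖ ^ 2 = - 2 * (1 / (2 * L) * ‖G x‖ ^ 2) := by field_simp
    rw [e1, e2] at h
    linarith
  calc ‖G x‖ ^ 2 = 2 * L * (1 / (2 * L) * ‖G x‖ ^ 2) := by field_simp
    _ ≤ _ := by gcongr

/-- The Hessian is positive semidefinite at a global minimizer. -/
theorem hessian_nonneg_of_min {φ : E → ℝ} {G : E → E} {G' : E → E →L[ℝ] E}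
    (hφ : ∀ x, HasFDerivAt φ (innerSL ℝ (G x)) x) (hG : ∀ x, HasFDerivAt G (G' x) x)
    {L : ℝ} (hL : ∀ x y, ‖G' x - G' y‖ ≤ L * ‖x - y‖) {x : E} (hx : ∀ z, φ x ≤ φ z)
    (hg : G x = 0) (v : E) : 0 ≤ ⟪v, G' x v⟫ := by
  have h : ∀ t : ℝ, 0 < t → 0 ≤ ⟪v, G' x v⟫ + t * (L / 3 * ‖v‖ ^ 3) := by
    intro t ht
    have h := (abs_le.1 (abs_sub_quadratic_le hφ hG hL x (t • v))).2
    have h2 := hx (x + t • v)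
    rw [hg, inner_zero_left, map_smul, real_inner_smul_left, real_inner_smul_right, norm_smul,
      Real.norm_of_nonneg ht.le] at h
    have : 0 ≤ t ^ 2 * (⟪v, G' x v⟫ + t * (L / 3 * ‖v‖ ^ 3)) := by nlinarith
    exact nonneg_of_mul_nonneg_right this (by positivity)
  have hc : Tendsto (fun t : ℝ => ⟪v, G' x v⟫ + t * (L / 3 * ‖v‖ ^ 3)) (𝓝[>] 0)
      (𝓝 (⟪v, G' x v⟫ + 0 * (L / 3 * ‖v‖ ^ 3))) := by
    apply Tendsto.mono_left _ nhdsWithin_le_nhds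
    exact Continuous.tendsto (by fun_prop) 0
  have := ge_of_tendsto hc (eventually_mem_nhdsWithin.mono fun t ht => h t ht)
  simpa using this

/-- A symmetric operator is bounded by the bound on its quadratic form. -/
theorem norm_apply_le_of_abs_inner_le {T : E →L[ℝ] E} (hT : ∀ u v, ⟪T u, v⟫ = ⟪u, T v⟫) {c : ℝ}
    (hc : ∀ v, |⟪v, T v⟫| ≤ c * ‖v‖ ^ 2) (v : E) : ‖T v‖ ≤ c * ‖v‖ := by
  have hbil : ∀ x y, 2 * ⟪T x, y⟫ ≤ c * (‖x‖ ^ 2 + ‖y‖ ^ 2) := by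
    intro x y
    have h1 := (abs_le.1 (hc (x + y))).2
    have h2 := (abs_le.1 (hc (x - y))).1
    have h3 := parallelogram_law_with_norm ℝ x y
    simp only [map_add, map_sub, inner_add_left, inner_add_right, inner_sub_left,
      inner_sub_right] at h1 h2
    have e1 : ⟪x, T y⟫ = ⟪T x, y⟫ := (hT x y).symm
    have e2 : ⟪y, T x⟫ = ⟪T x, y⟫ := real_inner_comm _ _
    rw [e1, e2] at h1 h2
    have h4 : c * (‖x + y‖ ^ 2 + ‖x - y‖ ^ 2) = c * (2 * (‖x‖ ^ 2 + ‖y‖ ^ 2)) := by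
      congr 1
    nlinarith
  rcases eq_or_ne (T v) 0 with h0 | h0
  · have := hc v
    rw [h0] at this ⊢
    simp only [inner_zero_right, abs_zero] at this
    rw [norm_zero]
    rcases eq_or_ne v 0 with rfl | hv
    · simp
    · have hv' : 0 < ‖v‖ := norm_pos_iff.2 hv
      by_contra hlt
      push Not at hlt
      nlinarith
  · have hv : v ≠ 0 := fun h => h0 (by simp [h])
    have hTp : 0 < ‖T v‖ := norm_pos_iff.2 h0
    have hvp : 0 < ‖v‖ := norm_pos_iff.2 hv
    -- The test vector is parallel to T v and rescaled to the length of v, which balances the two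
    -- squares in `hbil`.
    have h := hbil v ((‖v‖ / ‖T v‖) • T v)
    rw [real_inner_smul_right, real_inner_self_eq_norm_sq, norm_smul, Real.norm_of_nonneg
      (by positivity), div_mul_cancel₀ _ hTp.ne'] at h
    have e : ‖v‖ / ‖T v‖ * ‖T v‖ ^ 2 = ‖v‖ * ‖T v‖ := by field_simp
    rw [e] at h
    have : ‖v‖ * ‖T v‖ ≤ ‖v‖ * (c * ‖v‖) := by nlinarith
    exact le_of_mul_le_mul_left this hvp

/-! ### Optimality conditions for a quadratic on a ball. -/

section TrustRegion

variable {B : E →L[ℝ] E} {g s : E} {R : ℝ}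

theorem quadratic_add (hB : ∀ u v, ⟪B u, v⟫ = ⟪u, B v⟫) (g s v : E) :
    ⟪g, s + v⟫ + 1 / 2 * ⟪s + v, B (s + v)⟫
      = ⟪g, s⟫ + 1 / 2 * ⟪s, B s⟫ + ⟪g + B s, v⟫ + 1 / 2 * ⟪v, B v⟫ := by
  simp only [map_add, inner_add_left, inner_add_right]
  rw [real_inner_comm (B s) v, hB s v]
  ring

theorem inner_nonneg_of_feasible (hB : ∀ u v, ⟪B u, v⟫ = ⟪u, B v⟫)
    (hmin : ∀ s', ‖s'‖ ≤ R → ⟪g, s⟫ + 1 / 2 * ⟪s, B s⟫ ≤ ⟪g, s'⟫ + 1 / 2 * ⟪s', B s'⟫)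
    {v : E} (hv : ∀ᶠ t : ℝ in 𝓝[>] 0, ‖s + t • v‖ ≤ R) : 0 ≤ ⟪g + B s, v⟫ := by
  have h : ∀ᶠ t : ℝ in 𝓝[>] 0, 0 ≤ ⟪g + B s, v⟫ + t * (1 / 2 * ⟪v, B v⟫) := by
    filter_upwards [hv, self_mem_nhdsWithin] with t ht ht0
    have h1 := hmin _ ht
    rw [quadratic_add hB, map_smul, real_inner_smul_left, real_inner_smul_right,
      real_inner_smul_right] at h1
    have ht0' : 0 < t := ht0
    have : 0 ≤ t * (⟪g + B s, v⟫ + t * (1 / 2 * ⟪v, B v⟫)) := by linarith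
    exact nonneg_of_mul_nonneg_right this ht0'
  have hc : Tendsto (fun t : ℝ => ⟪g + B s, v⟫ + t * (1 / 2 * ⟪v, B v⟫)) (𝓝[>] 0)
      (𝓝 (⟪g + B s, v⟫ + 0 * (1 / 2 * ⟪v, B v⟫))) := by
    apply Tendsto.mono_left _ nhdsWithin_le_nhds
    exact Continuous.tendsto (by fun_prop) 0
  simpa using ge_of_tendsto hc h

theorem eventually_feasible_of_norm_lt (hs : ‖s‖ < R) (v : E) :
    ∀ᶠ t : ℝ in 𝓝[>] 0, ‖s + t • v‖ ≤ R := by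
  have hc : Tendsto (fun t : ℝ => ‖s + t • v‖) (𝓝[>] 0) (𝓝 ‖s + (0 : ℝ) • v‖) := by
    apply Tendsto.mono_left _ nhdsWithin_le_nhds
    exact Continuous.tendsto (by fun_prop) 0
  rw [zero_smul, add_zero] at hc
  exact (hc.eventually (gt_mem_nhds hs)).mono fun _ h => h.le

/-- First-order condition at an interior solution of the trust region subproblem. -/
theorem grad_eq_zero_of_interior (hB : ∀ u v, ⟪B u, v⟫ = ⟪u, B v⟫) (hs : ‖s‖ < R)
    (hmin : ∀ s', ‖s'‖ ≤ R → ⟪g, s⟫ + 1 / 2 * ⟪s, B s⟫ ≤ ⟪g, s'⟫ + 1 / 2 * ⟪s', B s'⟫) :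
    g + B s = 0 := by
  have h := inner_nonneg_of_feasible hB hmin (eventually_feasible_of_norm_lt hs (-(g + B s)))
  rw [inner_neg_right, real_inner_self_eq_norm_sq] at h
  have : ‖g + B s‖ = 0 := by nlinarith [norm_nonneg (g + B s)]
  exact norm_eq_zero.1 this

/-- Every direction with ⟪s, v⟫ < 0 enters the ball, so g + B s pairs nonnegatively with an open
half-space and must be a nonpositive multiple of s. -/
theorem exists_multiplier_of_boundary (hB : ∀ u v, ⟪B u, v⟫ = ⟪u, B v⟫) (hR : 0 < R)
    (hs : ‖s‖ = R)
    (hmin : ∀ s', ‖s'‖ ≤ R → ⟪g, s⟫ + 1 / 2 * ⟪s, B s⟫ ≤ ⟪g, s'⟫ + 1 / 2 * ⟪s', B s'⟫) :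
    ∃ lam : ℝ, 0 ≤ lam ∧ g + B s = -(lam • s) := by
  set p := g + B s with hp
  have hss : ⟪s, s⟫ = R ^ 2 := by rw [real_inner_self_eq_norm_sq, hs]
  have hdir : ∀ v, ⟪s, v⟫ < 0 → 0 ≤ ⟪p, v⟫ := by
    intro v hv
    apply inner_nonneg_of_feasible hB hmin
    have hc : Tendsto (fun t : ℝ => 2 * ⟪s, v⟫ + t * ‖v‖ ^ 2) (𝓝[>] 0)
        (𝓝 (2 * ⟪s, v⟫ + 0 * ‖v‖ ^ 2)) := by
      apply Tendsto.mono_left _ nhdsWithin_le_nhds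
      exact Continuous.tendsto (by fun_prop) 0
    have hneg : 2 * ⟪s, v⟫ + 0 * ‖v‖ ^ 2 < 0 := by linarith
    filter_upwards [hc.eventually (gt_mem_nhds hneg), self_mem_nhdsWithin]
      with t ht ht0
    have ht0' : 0 < t := ht0
    apply le_of_sq_le_sq _ hR.le
    rw [norm_add_sq_real, hs, real_inner_smul_right, norm_smul, Real.norm_of_nonneg ht0'.le]
    nlinarith
  have hps : ⟪p, s⟫ ≤ 0 := by
    have := hdir (-s) (by rw [inner_neg_right, hss]; simp [hR])
    rw [inner_neg_right] at this
    linarith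
  set lam := -⟪p, s⟫ / R ^ 2 with hlam
  have hlam0 : 0 ≤ lam := div_nonneg (by linarith) (by positivity)
  have hps' : ⟪p, s⟫ = -lam * R ^ 2 := by rw [hlam]; field_simp
  refine ⟨lam, hlam0, ?_⟩
  set u := p + lam • s with hu
  have hsu : ⟪s, u⟫ = 0 := by
    rw [hu, inner_add_right, real_inner_smul_right, hss, real_inner_comm, hps']; ring
  have hpu : ⟪p, u⟫ = ‖u‖ ^ 2 := by
    have : p = u - lam • s := by rw [hu]; abel
    rw [this, inner_sub_left, real_inner_smul_left, hsu, real_inner_self_eq_norm_sq]; ring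
  have hbd : ∀ δ : ℝ, 0 < δ → ‖u‖ ^ 2 ≤ δ * (lam * R ^ 2) := by
    intro δ hδ
    -- The component u of p orthogonal to s is tested against -u, tilted inward by δ s to become
    -- admissible; δ → 0 then kills u.
    have := hdir (-u - δ • s) (by
      rw [inner_sub_right, inner_neg_right, hsu, real_inner_smul_right, hss]
      have : 0 < δ * R ^ 2 := by positivity
      linarith)
    rw [inner_sub_right, inner_neg_right, hpu, real_inner_smul_right, hps'] at this
    linarith
  have hu0 : ‖u‖ ^ 2 ≤ 0 := by
    have hc : Tendsto (fun δ : ℝ => δ * (lam * R ^ 2)) (𝓝[>] 0) (𝓝 (0 * (lam * R ^ 2))) := by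
      apply Tendsto.mono_left _ nhdsWithin_le_nhds
      exact Continuous.tendsto (by fun_prop) 0
    rw [zero_mul] at hc
    exact ge_of_tendsto hc (eventually_mem_nhdsWithin.mono fun t ht => hbd t ht)
  have : u = 0 := by
    rw [← norm_eq_zero]; nlinarith [norm_nonneg u]
  rw [hu] at this
  exact eq_neg_of_add_eq_zero_left this

/-- Optimality conditions of the trust region subproblem. -/
theorem exists_multiplier (hB : ∀ u v, ⟪B u, v⟫ = ⟪u, B v⟫) (hR : 0 < R) (hs : ‖s‖ ≤ R)
    (hmin : ∀ s', ‖s'‖ ≤ R → ⟪g, s⟫ + 1 / 2 * ⟪s, B s⟫ ≤ ⟪g, s'⟫ + 1 / 2 * ⟪s', B s'⟫) :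
    ∃ lam : ℝ, 0 ≤ lam ∧ g + B s = -(lam • s) ∧ (∀ v, 0 ≤ ⟪v, B v⟫ + lam * ‖v‖ ^ 2) ∧
      (‖s‖ < R → lam = 0) := by
  rcases hs.lt_or_eq with hlt | heq
  · have h0 := grad_eq_zero_of_interior hB hlt hmin
    refine ⟨0, le_rfl, by simpa using h0, fun v => ?_, fun _ => rfl⟩
    obtain ⟨t, ht, ht0⟩ :=
      ((eventually_feasible_of_norm_lt hlt v).and self_mem_nhdsWithin).exists
    have ht0' : 0 < t := ht0
    have h1 := hmin _ ht
    rw [quadratic_add hB, h0, inner_zero_left, map_smul, real_inner_smul_left,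
      real_inner_smul_right] at h1
    have : 0 ≤ t ^ 2 * ⟪v, B v⟫ := by linarith
    simpa using nonneg_of_mul_nonneg_right this (by positivity)
  · obtain ⟨lam, hlam, hgs⟩ := exists_multiplier_of_boundary hB hR heq hmin
    refine ⟨lam, hlam, hgs, ?_, fun h => absurd heq h.ne⟩
    have hne : ∀ v, ⟪s, v⟫ ≠ 0 → 0 ≤ ⟪v, B v⟫ + lam * ‖v‖ ^ 2 := by
      intro v hv
      have hv0 : v ≠ 0 := fun h => hv (by simp [h])
      have hvp : 0 < ‖v‖ := norm_pos_iff.2 hv0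
      -- s + τ v is the second point where the line through s along v meets the sphere; there the
      -- model difference is exactly τ²/2 (⟪v, B v⟫ + lam ‖v‖²).
      set τ := -2 * ⟪s, v⟫ / ‖v‖ ^ 2 with hτ
      have hτv : τ * ‖v‖ ^ 2 = -2 * ⟪s, v⟫ := by rw [hτ]; field_simp
      have hτ0 : τ ≠ 0 := by
        rw [hτ]; exact div_ne_zero (mul_ne_zero (by norm_num) hv) (by positivity)
      have hfe : ‖s + τ • v‖ ≤ R := by
        apply le_of_sq_le_sq _ hR.le
        rw [norm_add_sq_real, heq, real_inner_smul_right, norm_smul, mul_pow, Real.norm_eq_abs,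
          sq_abs]
        have : τ ^ 2 * ‖v‖ ^ 2 = τ * (-2 * ⟪s, v⟫) := by rw [← hτv]; ring
        linarith
      have h1 := hmin _ hfe
      rw [quadratic_add hB, hgs, inner_neg_left, map_smul, real_inner_smul_left,
        real_inner_smul_left, real_inner_smul_right, real_inner_smul_right] at h1
      have h2 : τ * ⟪s, v⟫ = -(τ ^ 2 * ‖v‖ ^ 2) / 2 := by
        have : ⟪s, v⟫ = -(τ * ‖v‖ ^ 2) / 2 := by rw [hτv]; ring
        rw [this]; ring
      have : 0 ≤ τ ^ 2 * (⟪v, B v⟫ + lam * ‖v‖ ^ 2) := by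
        rw [h2] at h1; nlinarith
      exact nonneg_of_mul_nonneg_right this (by positivity)
    intro v
    by_cases hv : ⟪s, v⟫ = 0
    -- A direction tangent to the sphere is a limit of the non-tangent directions v + δ s.
    · have hc : Tendsto (fun δ : ℝ => ⟪v + δ • s, B (v + δ • s)⟫ + lam * ‖v + δ • s‖ ^ 2) (𝓝[>] 0)
          (𝓝 (⟪v + (0 : ℝ) • s, B (v + (0 : ℝ) • s)⟫ + lam * ‖v + (0 : ℝ) • s‖ ^ 2)) := by
        apply Tendsto.mono_left _ nhdsWithin_le_nhds
        exact Continuous.tendsto (by fun_prop) 0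
      have := ge_of_tendsto hc (eventually_mem_nhdsWithin.mono fun δ hδ => hne (v + δ • s) (by
        rw [inner_add_right, hv, real_inner_smul_right, real_inner_self_eq_norm_sq, heq]
        have : (0 : ℝ) < δ := hδ
        positivity))
      simpa using this
    · exact hne v hv

end TrustRegion

/-! ### Consequences of strong concavity. -/

section StrongConcave

variable {φ : E → ℝ} {G : E → E} {μ : ℝ}

theorem le_of_strongConcaveOn (hc : StrongConcaveOn univ μ φ)
    (hφ : ∀ x, HasFDerivAt φ (innerSL ℝ (G x)) x) (x y : E) :
    φ y ≤ φ x + ⟪G x, y - x⟫ - μ / 2 * ‖y - x‖ ^ 2 := by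
  have hd : HasDerivAt (fun t : ℝ => φ (x + t • (y - x))) ⟪G x, y - x⟫ 0 := by
    have h0 : HasFDerivAt φ (innerSL ℝ (G x)) (x + (0 : ℝ) • (y - x)) := by simpa using hφ x
    exact h0.comp_hasDerivAt (0 : ℝ) (hasDerivAt_line x (y - x) 0)
  have h1 : Tendsto (fun t : ℝ => t⁻¹ • (φ (x + (0 + t) • (y - x)) - φ (x + (0 : ℝ) • (y - x))))
      (𝓝[>] 0) (𝓝 ⟪G x, y - x⟫) :=
    hd.tendsto_slope_zero.mono_left (nhdsWithin_mono _ fun t ht => ne_of_gt ht)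
  have h2 : Tendsto (fun t : ℝ => φ y - φ x + (1 - t) * (μ / 2 * ‖y - x‖ ^ 2)) (𝓝[>] 0)
      (𝓝 (φ y - φ x + (1 - 0) * (μ / 2 * ‖y - x‖ ^ 2))) := by
    apply Tendsto.mono_left _ nhdsWithin_le_nhds
    exact Continuous.tendsto (by fun_prop) 0
  have h3 : ∀ᶠ t : ℝ in 𝓝[>] 0, φ y - φ x + (1 - t) * (μ / 2 * ‖y - x‖ ^ 2)
      ≤ t⁻¹ • (φ (x + (0 + t) • (y - x)) - φ (x + (0 : ℝ) • (y - x))) := by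
    filter_upwards [Ioo_mem_nhdsGT (zero_lt_one' ℝ)] with t ht
    have h4 := hc.2 (mem_univ x) (mem_univ y) (show 0 ≤ 1 - t by linarith [ht.2]) ht.1.le
      (by ring)
    have e : (1 - t) • x + t • y = x + (0 + t) • (y - x) := by
      rw [zero_add, smul_sub, sub_smul, one_smul]; abel
    rw [e, norm_sub_rev x y] at h4
    simp only [smul_eq_mul] at h4
    rw [zero_smul, add_zero, smul_eq_mul, inv_mul_eq_div, le_div_iff₀ ht.1]
    nlinarith
  have := le_of_tendsto_of_tendsto h2 h1 h3
  linarith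

theorem inner_grad_sub_le (hc : StrongConcaveOn univ μ φ)
    (hφ : ∀ x, HasFDerivAt φ (innerSL ℝ (G x)) x) (x y : E) :
    ⟪G x - G y, x - y⟫ ≤ -μ * ‖x - y‖ ^ 2 := by
  have h1 := le_of_strongConcaveOn hc hφ x y
  have h2 := le_of_strongConcaveOn hc hφ y x
  rw [← neg_sub x y, inner_neg_right, norm_neg] at h1
  rw [inner_sub_left]
  linarith

theorem inner_hessian_le (hc : StrongConcaveOn univ μ φ)
    (hφ : ∀ x, HasFDerivAt φ (innerSL ℝ (G x)) x) {T : E →L[ℝ] E} {x : E}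
    (hT : HasFDerivAt G T x) (v : E) : ⟪v, T v⟫ ≤ -μ * ‖v‖ ^ 2 := by
  have hd : HasDerivAt (fun t : ℝ => ⟪v, G (x + t • v)⟫) ⟪v, T v⟫ 0 := by
    have h0 : HasFDerivAt G T (x + (0 : ℝ) • v) := by simpa using hT
    have h1 := h0.comp_hasDerivAt (0 : ℝ) (hasDerivAt_line x v 0)
    exact (innerSL ℝ v).hasFDerivAt.comp_hasDerivAt (0 : ℝ) h1
  have h1 := hd.tendsto_slope_zero.mono_left
    (nhdsWithin_mono (0 : ℝ) (fun t ht => ne_of_gt ht : Ioi (0 : ℝ) ⊆ {0}ᶜ))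
  refine le_of_tendsto h1 (eventually_mem_nhdsWithin.mono fun t ht => ?_)
  have ht' : (0 : ℝ) < t := ht
  have h := inner_grad_sub_le hc hφ (x + t • v) x
  rw [add_sub_cancel_left, real_inner_smul_right, real_inner_comm, inner_sub_right, norm_smul,
    Real.norm_of_nonneg ht'.le] at h
  simp only [zero_add, zero_smul, add_zero, smul_eq_mul]
  rw [inv_mul_eq_div, div_le_iff₀ ht']
  have : t * (⟪v, G (x + t • v)⟫ - ⟪v, G x⟫) ≤ t * (-μ * ‖v‖ ^ 2 * t) := by nlinarith
  exact le_of_mul_le_mul_left this ht'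

/-- For ‖y‖ ≥ 2‖G 0‖/μ the quadratic term beats the linear one, so φ y ≤ φ 0 outside a ball and
compactness applies. -/
theorem exists_isMaxOn_of_strongConcaveOn [FiniteDimensional ℝ E] (hμ : 0 < μ)
    (hc : StrongConcaveOn univ μ φ) (hφ : ∀ x, HasFDerivAt φ (innerSL ℝ (G x)) x) :
    ∃ y, IsMaxOn φ univ y := by
  have hcont : Continuous φ := continuous_iff_continuousAt.2 fun x => (hφ x).continuousAt
  have : ProperSpace E := FiniteDimensional.proper ℝ E
  obtain ⟨y, hy⟩ := hcont.exists_forall_ge' 0 (by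
    have hfar := (tendsto_norm_cocompact_atTop (E := E)).eventually_ge_atTop (2 * ‖G 0‖ / μ)
    filter_upwards [hfar] with y hy
    have h := le_of_strongConcaveOn hc hφ 0 y
    rw [sub_zero] at h
    have h2 := real_inner_le_norm (G 0) y
    rw [div_le_iff₀ hμ] at hy
    nlinarith [norm_nonneg y])
  exact ⟨y, fun z _ => hy z⟩

end StrongConcave

end Inner

end GRTR
namespace GRTR

open Set Filter Topology

/-! ### The Euclidean norm of a pair. -/

section PairNorm

variable {n m : ℕ}

theorem norm_fst_le_pairNorm (a : Rn n) (b : Rn m) : ‖a‖ ≤ pairNorm a b :=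
  Real.le_sqrt_of_sq_le (by nlinarith [sq_nonneg ‖b‖])

theorem norm_snd_le_pairNorm (a : Rn n) (b : Rn m) : ‖b‖ ≤ pairNorm a b :=
  Real.le_sqrt_of_sq_le (by nlinarith [sq_nonneg ‖a‖])

theorem pairNorm_nonneg (a : Rn n) (b : Rn m) : 0 ≤ pairNorm a b := Real.sqrt_nonneg _

theorem pairNorm_zero_right (a : Rn n) : pairNorm a (0 : Rn m) = ‖a‖ := by
  simp [pairNorm, Real.sqrt_sq]

theorem pairNorm_zero_left (b : Rn m) : pairNorm (0 : Rn n) b = ‖b‖ := by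
  simp [pairNorm, Real.sqrt_sq]

theorem pairNorm_le_add (a : Rn n) (b : Rn m) : pairNorm a b ≤ ‖a‖ + ‖b‖ := by
  rw [pairNorm, Real.sqrt_le_left (by positivity)]
  nlinarith [norm_nonneg a, norm_nonneg b, mul_nonneg (norm_nonneg a) (norm_nonneg b)]

end PairNorm

/-! ### Partial gradients and Hessian blocks as parts of Fréchet derivatives. -/

section PartialDerivatives

variable {n m : ℕ} {f : Rn n → Rn m → ℝ}

local notation "⟪" x ", " y "⟫" => inner ℝ x y

theorem hasFDerivAt_left (hf : ContDiff ℝ 2 (fun p : Rn n × Rn m => f p.1 p.2))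
    (x : Rn n) (y : Rn m) : HasFDerivAt (fun x' => f x' y) (innerSL ℝ (gradX f x y)) x := by
  have h1 : DifferentiableAt ℝ (fun x' => f x' y) x := by
    have := (hf.differentiable (by norm_num)).comp
      (f := fun x' : Rn n => (x', y)) (by fun_prop)
    exact this x
  exact hasGradientAt_iff_hasFDerivAt.1 h1.hasGradientAt

theorem hasFDerivAt_right (hf : ContDiff ℝ 2 (fun p : Rn n × Rn m => f p.1 p.2))
    (x : Rn n) (y : Rn m) : HasFDerivAt (fun y' => f x y') (innerSL ℝ (gradY f x y)) y := by
  have h1 : DifferentiableAt ℝ (fun y' => f x y') y := by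
    have := (hf.differentiable (by norm_num)).comp
      (f := fun y' : Rn m => (x, y')) (by fun_prop)
    exact this y
  exact hasGradientAt_iff_hasFDerivAt.1 h1.hasGradientAt

theorem inner_gradX (hf : ContDiff ℝ 2 (fun p : Rn n × Rn m => f p.1 p.2))
    (p : Rn n × Rn m) (a : Rn n) :
    ⟪gradX f p.1 p.2, a⟫ = fderiv ℝ (fun p : Rn n × Rn m => f p.1 p.2) p (a, 0) := by
  have h1 := HasFDerivAt.comp (f := fun a : Rn n => (a, p.2)) p.1
    (hf.differentiable (by norm_num) p).hasFDerivAt (hasFDerivAt_prodMk_left p.1 p.2)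
  have := congrArg (fun T : Rn n →L[ℝ] ℝ => T a) ((hasFDerivAt_left hf p.1 p.2).unique h1)
  simpa using this

theorem inner_gradY (hf : ContDiff ℝ 2 (fun p : Rn n × Rn m => f p.1 p.2))
    (p : Rn n × Rn m) (b : Rn m) :
    ⟪gradY f p.1 p.2, b⟫ = fderiv ℝ (fun p : Rn n × Rn m => f p.1 p.2) p (0, b) := by
  have h1 := HasFDerivAt.comp (f := fun b : Rn m => (p.1, b)) p.2
    (hf.differentiable (by norm_num) p).hasFDerivAt (hasFDerivAt_prodMk_right p.1 p.2)
  have := congrArg (fun T : Rn m →L[ℝ] ℝ => T b) ((hasFDerivAt_right hf p.1 p.2).unique h1)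
  simpa using this

theorem hasFDerivAt_uncurry (hf : ContDiff ℝ 2 (fun p : Rn n × Rn m => f p.1 p.2))
    (p : Rn n × Rn m) : HasFDerivAt (fun p : Rn n × Rn m => f p.1 p.2)
      ((innerSL ℝ (gradX f p.1 p.2)).comp (ContinuousLinearMap.fst ℝ (Rn n) (Rn m))
        + (innerSL ℝ (gradY f p.1 p.2)).comp (ContinuousLinearMap.snd ℝ (Rn n) (Rn m))) p := by
  refine (hf.differentiable (by norm_num) p).hasFDerivAt.congr_fderiv ?_
  refine ContinuousLinearMap.ext fun v => ?_
  have : v = (v.1, 0) + (0, v.2) := by simp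
  conv_lhs => rw [this, map_add, ← inner_gradX hf, ← inner_gradY hf]
  simp

theorem differentiable_gradX (hf : ContDiff ℝ 2 (fun p : Rn n × Rn m => f p.1 p.2)) :
    Differentiable ℝ (fun p : Rn n × Rn m => gradX f p.1 p.2) := by
  have h1 : Differentiable ℝ (fderiv ℝ (fun p : Rn n × Rn m => f p.1 p.2)) :=
    (hf.fderiv_right (m := 1) (by norm_num)).differentiable (by norm_num)
  have h2 : (fun p : Rn n × Rn m => gradX f p.1 p.2) = fun p =>
      (InnerProductSpace.toDual ℝ (Rn n)).symm
        ((fderiv ℝ (fun p : Rn n × Rn m => f p.1 p.2) p).comp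
          (ContinuousLinearMap.inl ℝ (Rn n) (Rn m))) := by
    funext p
    refine ext_inner_right ℝ fun a => ?_
    rw [InnerProductSpace.toDual_symm_apply, inner_gradX hf]
    simp
  rw [h2]
  exact (InnerProductSpace.toDual ℝ (Rn n)).symm.toContinuousLinearEquiv.differentiable.comp
    (h1.clm_comp (differentiable_const _))

theorem differentiable_gradY (hf : ContDiff ℝ 2 (fun p : Rn n × Rn m => f p.1 p.2)) :
    Differentiable ℝ (fun p : Rn n × Rn m => gradY f p.1 p.2) := by
  have h1 : Differentiable ℝ (fderiv ℝ (fun p : Rn n × Rn m => f p.1 p.2)) :=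
    (hf.fderiv_right (m := 1) (by norm_num)).differentiable (by norm_num)
  have h2 : (fun p : Rn n × Rn m => gradY f p.1 p.2) = fun p =>
      (InnerProductSpace.toDual ℝ (Rn m)).symm
        ((fderiv ℝ (fun p : Rn n × Rn m => f p.1 p.2) p).comp
          (ContinuousLinearMap.inr ℝ (Rn n) (Rn m))) := by
    funext p
    refine ext_inner_right ℝ fun a => ?_
    rw [InnerProductSpace.toDual_symm_apply, inner_gradY hf]
    simp
  rw [h2]
  exact (InnerProductSpace.toDual ℝ (Rn m)).symm.toContinuousLinearEquiv.differentiable.comp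
    (h1.clm_comp (differentiable_const _))

theorem hasFDerivAt_of_partials {G : Type*} [NormedAddCommGroup G] [NormedSpace ℝ G]
    {g : Rn n → Rn m → G} {x : Rn n} {y : Rn m}
    (hg : DifferentiableAt ℝ (fun p : Rn n × Rn m => g p.1 p.2) (x, y)) :
    HasFDerivAt (fun p : Rn n × Rn m => g p.1 p.2)
      ((fderiv ℝ (fun x' => g x' y) x).comp (ContinuousLinearMap.fst ℝ (Rn n) (Rn m))
        + (fderiv ℝ (fun y' => g x y') y).comp (ContinuousLinearMap.snd ℝ (Rn n) (Rn m)))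
      (x, y) := by
  have h1 := (HasFDerivAt.comp (f := fun a : Rn n => (a, y)) x hg.hasFDerivAt
    (hasFDerivAt_prodMk_left x y)).fderiv
  have h2 := (HasFDerivAt.comp (f := fun b : Rn m => (x, b)) y hg.hasFDerivAt
    (hasFDerivAt_prodMk_right x y)).fderiv
  simp only [Function.comp_def] at h1 h2
  rw [h1, h2]
  refine hg.hasFDerivAt.congr_fderiv ?_
  refine ContinuousLinearMap.ext fun v => ?_
  simp [← map_add]

theorem hasFDerivAt_gradX (hf : ContDiff ℝ 2 (fun p : Rn n × Rn m => f p.1 p.2))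
    (x : Rn n) (y : Rn m) : HasFDerivAt (fun p : Rn n × Rn m => gradX f p.1 p.2)
      ((hessXX f x y).comp (ContinuousLinearMap.fst ℝ (Rn n) (Rn m))
        + (hessXY f x y).comp (ContinuousLinearMap.snd ℝ (Rn n) (Rn m))) (x, y) :=
  hasFDerivAt_of_partials (differentiable_gradX hf (x, y))

theorem hasFDerivAt_gradY (hf : ContDiff ℝ 2 (fun p : Rn n × Rn m => f p.1 p.2))
    (x : Rn n) (y : Rn m) : HasFDerivAt (fun p : Rn n × Rn m => gradY f p.1 p.2)
      ((hessYX f x y).comp (ContinuousLinearMap.fst ℝ (Rn n) (Rn m))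
        + (hessYY f x y).comp (ContinuousLinearMap.snd ℝ (Rn n) (Rn m))) (x, y) :=
  hasFDerivAt_of_partials (differentiable_gradY hf (x, y))

theorem hasFDerivAt_gradY_right (hf : ContDiff ℝ 2 (fun p : Rn n × Rn m => f p.1 p.2))
    (x : Rn n) (y : Rn m) : HasFDerivAt (fun y' => gradY f x y') (hessYY f x y) y := by
  have := (differentiable_gradY hf).comp (f := fun y' : Rn m => (x, y')) (by fun_prop)
  exact (this y).hasFDerivAt

theorem hasFDerivAt_fderiv_apply (hf : ContDiff ℝ 2 (fun p : Rn n × Rn m => f p.1 p.2))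
    (p w : Rn n × Rn m) :
    HasFDerivAt (fun q => fderiv ℝ (fun p : Rn n × Rn m => f p.1 p.2) q w)
      ((fderiv ℝ (fderiv ℝ (fun p : Rn n × Rn m => f p.1 p.2)) p).flip w) p := by
  have h1 : Differentiable ℝ (fderiv ℝ (fun p : Rn n × Rn m => f p.1 p.2)) :=
    (hf.fderiv_right (m := 1) (by norm_num)).differentiable (by norm_num)
  refine ((h1 p).hasFDerivAt.clm_apply (hasFDerivAt_const w p)).congr_fderiv ?_
  ext <;> simp

/-- Together with `inner_hessY` this expresses all four blocks through one second Fréchet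
derivative, so the symmetry of the latter yields the symmetry of the diagonal blocks and the
adjointness of the mixed ones. -/
theorem inner_hessX (hf : ContDiff ℝ 2 (fun p : Rn n × Rn m => f p.1 p.2))
    (x : Rn n) (y : Rn m) (a a' : Rn n) (b : Rn m) :
    ⟪hessXX f x y a + hessXY f x y b, a'⟫
      = fderiv ℝ (fderiv ℝ (fun p : Rn n × Rn m => f p.1 p.2)) (x, y) (a, b) (a', 0) := by
  have h1 := ((innerSL ℝ a').hasFDerivAt).comp (x, y) (hasFDerivAt_gradX hf x y)
  have e : (fun q => fderiv ℝ (fun p : Rn n × Rn m => f p.1 p.2) q (a', 0))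
      = (innerSL ℝ a') ∘ (fun p : Rn n × Rn m => gradX f p.1 p.2) := by
    funext q
    rw [← inner_gradX hf]
    exact real_inner_comm _ _
  have h2 := hasFDerivAt_fderiv_apply hf (x, y) (a', 0)
  rw [e] at h2
  have := congrArg (fun T : (Rn n × Rn m) →L[ℝ] ℝ => T (a, b)) (h1.unique h2)
  rw [real_inner_comm]
  simpa [inner_add_right] using this

theorem inner_hessY (hf : ContDiff ℝ 2 (fun p : Rn n × Rn m => f p.1 p.2))
    (x : Rn n) (y : Rn m) (a : Rn n) (b b' : Rn m) :
    ⟪hessYX f x y a + hessYY f x y b, b'⟫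
      = fderiv ℝ (fderiv ℝ (fun p : Rn n × Rn m => f p.1 p.2)) (x, y) (a, b) (0, b') := by
  have h1 := ((innerSL ℝ b').hasFDerivAt).comp (x, y) (hasFDerivAt_gradY hf x y)
  have e : (fun q => fderiv ℝ (fun p : Rn n × Rn m => f p.1 p.2) q (0, b'))
      = (innerSL ℝ b') ∘ (fun p : Rn n × Rn m => gradY f p.1 p.2) := by
    funext q
    rw [← inner_gradY hf]
    exact real_inner_comm _ _
  have h2 := hasFDerivAt_fderiv_apply hf (x, y) (0, b')
  rw [e] at h2
  have := congrArg (fun T : (Rn n × Rn m) →L[ℝ] ℝ => T (a, b)) (h1.unique h2)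
  rw [real_inner_comm]
  simpa [inner_add_right] using this

theorem fderiv_fderiv_comm (hf : ContDiff ℝ 2 (fun p : Rn n × Rn m => f p.1 p.2))
    (p v w : Rn n × Rn m) :
    fderiv ℝ (fderiv ℝ (fun p : Rn n × Rn m => f p.1 p.2)) p v w
      = fderiv ℝ (fderiv ℝ (fun p : Rn n × Rn m => f p.1 p.2)) p w v :=
  (hf.contDiffAt.isSymmSndFDerivAt (by simp)) v w

theorem hessXX_symm (hf : ContDiff ℝ 2 (fun p : Rn n × Rn m => f p.1 p.2))
    (x : Rn n) (y : Rn m) (a a' : Rn n) : ⟪hessXX f x y a, a'⟫ = ⟪a, hessXX f x y a'⟫ := by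
  have h1 := inner_hessX hf x y a a' 0
  have h2 := inner_hessX hf x y a' a 0
  rw [map_zero, add_zero] at h1 h2
  rw [h1, fderiv_fderiv_comm hf, ← h2, real_inner_comm]

theorem hessYY_symm (hf : ContDiff ℝ 2 (fun p : Rn n × Rn m => f p.1 p.2))
    (x : Rn n) (y : Rn m) (b b' : Rn m) : ⟪hessYY f x y b, b'⟫ = ⟪b, hessYY f x y b'⟫ := by
  have h1 := inner_hessY hf x y 0 b b'
  have h2 := inner_hessY hf x y 0 b' b
  rw [map_zero, zero_add] at h1 h2
  rw [h1, fderiv_fderiv_comm hf, ← h2, real_inner_comm]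

theorem hessXY_adjoint (hf : ContDiff ℝ 2 (fun p : Rn n × Rn m => f p.1 p.2))
    (x : Rn n) (y : Rn m) (b : Rn m) (a : Rn n) :
    ⟪hessXY f x y b, a⟫ = ⟪b, hessYX f x y a⟫ := by
  have h1 := inner_hessX hf x y 0 a b
  have h2 := inner_hessY hf x y a 0 b
  rw [map_zero, zero_add] at h1
  rw [map_zero, add_zero] at h2
  rw [h1, fderiv_fderiv_comm hf, ← h2, real_inner_comm]

end PartialDerivatives

/-! ### Norm and Lipschitz bounds for the Hessian blocks and the Schur complement. -/

section Bounds

variable {n m : ℕ} {f : Rn n → Rn m → ℝ} {ℓ μ ρ Pstar : ℝ}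

local notation "⟪" x ", " y "⟫" => inner ℝ x y

namespace Assumptions

theorem gradX_lipschitz (hA : Assumptions f ℓ μ ρ Pstar) (x x' : Rn n) (y y' : Rn m) :
    ‖gradX f x y - gradX f x' y'‖ ≤ ℓ * pairNorm (x - x') (y - y') :=
  (norm_fst_le_pairNorm _ _).trans (hA.grad_lipschitz x y x' y')

theorem gradY_lipschitz (hA : Assumptions f ℓ μ ρ Pstar) (x x' : Rn n) (y y' : Rn m) :
    ‖gradY f x y - gradY f x' y'‖ ≤ ℓ * pairNorm (x - x') (y - y') :=
  (norm_snd_le_pairNorm _ _).trans (hA.grad_lipschitz x y x' y')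

theorem norm_hessXX_le (hA : Assumptions f ℓ μ ρ Pstar) (hℓ : 0 < ℓ) (x : Rn n) (y : Rn m) :
    ‖hessXX f x y‖ ≤ ℓ :=
  norm_fderiv_le_of_lip' ℝ hℓ.le (Eventually.of_forall fun x' => by
    simpa [pairNorm_zero_right] using hA.gradX_lipschitz x' x y y)

theorem norm_hessXY_le (hA : Assumptions f ℓ μ ρ Pstar) (hℓ : 0 < ℓ) (x : Rn n) (y : Rn m) :
    ‖hessXY f x y‖ ≤ ℓ :=
  norm_fderiv_le_of_lip' ℝ hℓ.le (Eventually.of_forall fun y' => by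
    simpa [pairNorm_zero_left] using hA.gradX_lipschitz x x y' y)

theorem norm_hessYX_le (hA : Assumptions f ℓ μ ρ Pstar) (hℓ : 0 < ℓ) (x : Rn n) (y : Rn m) :
    ‖hessYX f x y‖ ≤ ℓ :=
  norm_fderiv_le_of_lip' ℝ hℓ.le (Eventually.of_forall fun x' => by
    simpa [pairNorm_zero_right] using hA.gradY_lipschitz x' x y y)

theorem norm_hessYY_le (hA : Assumptions f ℓ μ ρ Pstar) (hℓ : 0 < ℓ) (x : Rn n) (y : Rn m) :
    ‖hessYY f x y‖ ≤ ℓ :=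
  norm_fderiv_le_of_lip' ℝ hℓ.le (Eventually.of_forall fun y' => by
    simpa [pairNorm_zero_left] using hA.gradY_lipschitz x x y' y)

theorem inner_gradY_sub_le (hA : Assumptions f ℓ μ ρ Pstar) (x : Rn n) (y y' : Rn m) :
    ⟪gradY f x y - gradY f x y', y - y'⟫ ≤ -μ * ‖y - y'‖ ^ 2 :=
  inner_grad_sub_le (hA.strongConcave x) (fun y => hasFDerivAt_right hA.contDiff x y) y y'

theorem inner_hessYY_le (hA : Assumptions f ℓ μ ρ Pstar) (x : Rn n) (y v : Rn m) :
    ⟪v, hessYY f x y v⟫ ≤ -μ * ‖v‖ ^ 2 :=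
  inner_hessian_le (hA.strongConcave x) (fun y => hasFDerivAt_right hA.contDiff x y)
    (hasFDerivAt_gradY_right hA.contDiff x y) v

/-- A nonzero v, available since m is positive, has curvature at most -μ by strong concavity and at
least -ℓ by the Lipschitz gradient. This supplies κ ≥ 1. -/
theorem mu_le (hA : Assumptions f ℓ μ ρ Pstar) (hℓ : 0 < ℓ) (hm : 0 < m) : μ ≤ ℓ := by
  have : NeZero m := ⟨hm.ne'⟩
  obtain ⟨v, hv⟩ := exists_ne (0 : Rn m)
  have h1 := hA.inner_hessYY_le 0 0 v
  have h2 := (abs_le.1 (abs_real_inner_le_norm v (hessYY f 0 0 v))).1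
  have h3 := (hessYY f 0 0).le_of_opNorm_le (hA.norm_hessYY_le hℓ 0 0) v
  have hvp : 0 < ‖v‖ := norm_pos_iff.2 hv
  have h4 : ‖v‖ * ‖hessYY f 0 0 v‖ ≤ ‖v‖ * (ℓ * ‖v‖) := by gcongr
  have : μ * ‖v‖ ^ 2 ≤ ℓ * ‖v‖ ^ 2 := by nlinarith
  exact le_of_mul_le_mul_right this (by positivity)

theorem hessYY_norm_ge (hA : Assumptions f ℓ μ ρ Pstar) (x : Rn n) (y v : Rn m) :
    μ * ‖v‖ ≤ ‖hessYY f x y v‖ := by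
  rcases eq_or_ne v 0 with rfl | hv
  · simp
  have hvp : 0 < ‖v‖ := norm_pos_iff.2 hv
  have h1 := hA.inner_hessYY_le x y v
  have h2 := (abs_le.1 (abs_real_inner_le_norm v (hessYY f x y v))).1
  have : ‖v‖ * (μ * ‖v‖) ≤ ‖v‖ * ‖hessYY f x y v‖ := by nlinarith
  exact le_of_mul_le_mul_left this hvp

/-- The lower bound μ‖v‖ gives injectivity, which suffices in finite dimension. Hence `inverse` in
`schurH` is a true inverse and not the default 0. -/
theorem hessYY_isInvertible (hA : Assumptions f ℓ μ ρ Pstar) (hμ : 0 < μ) (x : Rn n) (y : Rn m) :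
    (hessYY f x y).IsInvertible := by
  have hinj : Function.Injective (hessYY f x y : Rn m →ₗ[ℝ] Rn m) := by
    rw [injective_iff_map_eq_zero]
    intro v hv
    have h := hA.hessYY_norm_ge x y v
    have hv' : hessYY f x y v = 0 := hv
    rw [hv', norm_zero] at h
    have h0 : ‖v‖ ≤ 0 := nonpos_of_mul_nonpos_right h hμ
    exact norm_le_zero_iff.1 h0
  exact ⟨(LinearEquiv.ofInjectiveEndo _ hinj).toContinuousLinearEquiv, by
    ext v
    simp⟩

theorem norm_inverse_apply_le (hA : Assumptions f ℓ μ ρ Pstar) (hμ : 0 < μ) (x : Rn n)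
    (y w : Rn m) : ‖(hessYY f x y).inverse w‖ ≤ 1 / μ * ‖w‖ := by
  have h := hA.hessYY_norm_ge x y ((hessYY f x y).inverse w)
  rw [(hA.hessYY_isInvertible hμ x y).self_apply_inverse] at h
  rw [one_div, inv_mul_eq_div, le_div_iff₀ hμ]
  linarith

theorem norm_inverse_le (hA : Assumptions f ℓ μ ρ Pstar) (hμ : 0 < μ) (x : Rn n)
    (y : Rn m) : ‖(hessYY f x y).inverse‖ ≤ 1 / μ :=
  ContinuousLinearMap.opNorm_le_bound _ (by positivity) (hA.norm_inverse_apply_le hμ x y)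

theorem inverse_symm (hA : Assumptions f ℓ μ ρ Pstar) (hμ : 0 < μ) (x : Rn n)
    (y u v : Rn m) : ⟪(hessYY f x y).inverse u, v⟫ = ⟪u, (hessYY f x y).inverse v⟫ := by
  have hi := hA.hessYY_isInvertible hμ x y
  conv_lhs => rw [← hi.self_apply_inverse v]
  rw [← hessYY_symm hA.contDiff, hi.self_apply_inverse]

theorem schurH_symm (hA : Assumptions f ℓ μ ρ Pstar) (hμ : 0 < μ) (x : Rn n)
    (y : Rn m) (u v : Rn n) : ⟪schurH f x y u, v⟫ = ⟪u, schurH f x y v⟫ := by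
  simp only [schurH, _root_.sub_apply, ContinuousLinearMap.comp_apply, inner_sub_left,
    inner_sub_right]
  rw [hessXX_symm hA.contDiff, hessXY_adjoint hA.contDiff, hA.inverse_symm hμ,
    ← real_inner_comm u, ← real_inner_comm u, hessXY_adjoint hA.contDiff,
    real_inner_comm (hessYX f x y u)]

theorem norm_schurH_le (hA : Assumptions f ℓ μ ρ Pstar) (hℓ : 0 < ℓ) (hμ : 0 < μ) (x : Rn n)
    (y : Rn m) : ‖schurH f x y‖ ≤ L1 ℓ μ := by
  have h1 := hA.norm_hessXX_le hℓ x y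
  have h2 := hA.norm_hessXY_le hℓ x y
  have h3 := hA.norm_hessYX_le hℓ x y
  have h4 := hA.norm_inverse_le hμ x y
  calc ‖schurH f x y‖ ≤ ‖hessXX f x y‖
        + ‖(hessXY f x y).comp ((hessYY f x y).inverse.comp (hessYX f x y))‖ := norm_sub_le _ _
    _ ≤ ‖hessXX f x y‖ + ‖hessXY f x y‖ * (‖(hessYY f x y).inverse‖ * ‖hessYX f x y‖) := by
        gcongr
        exact (ContinuousLinearMap.opNorm_comp_le _ _).trans
          (by gcongr; exact ContinuousLinearMap.opNorm_comp_le _ _)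
    _ ≤ ℓ + ℓ * (1 / μ * ℓ) := by gcongr
    _ = L1 ℓ μ := by rw [L1, kappa]; field_simp; ring

/-- Telescope the triple product one factor at a time and use A⁻¹ - B⁻¹ = -A⁻¹(A - B)B⁻¹. The four
contributions are ρ, κρ, κ²ρ and κρ, which add up to ρ(1+κ)². -/
theorem schurH_lipschitz (hA : Assumptions f ℓ μ ρ Pstar) (hℓ : 0 < ℓ) (hμ : 0 < μ) (hρ : 0 < ρ)
    (x x' : Rn n) (y y' : Rn m) :
    ‖schurH f x y - schurH f x' y'‖ ≤ LH ℓ μ ρ * pairNorm (x - x') (y - y') := by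
  set d := pairNorm (x - x') (y - y') with hd
  have hd0 : 0 ≤ d := pairNorm_nonneg _ _
  set A := hessYY f x y with hAdef
  set B := hessYY f x' y' with hBdef
  have hiA := hA.hessYY_isInvertible hμ x y
  have hiB := hA.hessYY_isInvertible hμ x' y'
  have hnA := hA.norm_inverse_le hμ x y
  have hnB := hA.norm_inverse_le hμ x' y'
  have hAB : ‖A.inverse - B.inverse‖ ≤ 1 / μ * (ρ * d) * (1 / μ) := by
    have e : A.inverse - B.inverse = -(A.inverse.comp ((A - B).comp B.inverse)) := by
      ext1 v
      simp only [_root_.sub_apply, _root_.neg_apply, ContinuousLinearMap.comp_apply,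
        map_sub]
      rw [hiA.inverse_apply_self, hiB.self_apply_inverse, neg_sub]
    rw [e, norm_neg]
    calc _ ≤ ‖A.inverse‖ * (‖A - B‖ * ‖B.inverse‖) :=
          (ContinuousLinearMap.opNorm_comp_le _ _).trans
            (by gcongr; exact ContinuousLinearMap.opNorm_comp_le _ _)
      _ ≤ 1 / μ * ((ρ * d) * (1 / μ)) := by gcongr; exact hA.hessYY_lipschitz x y x' y'
      _ = _ := by ring
  have e : schurH f x y - schurH f x' y' = (hessXX f x y - hessXX f x' y')
      - ((hessXY f x y - hessXY f x' y').comp (A.inverse.comp (hessYX f x y))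
        + (hessXY f x' y').comp ((A.inverse - B.inverse).comp (hessYX f x y))
        + (hessXY f x' y').comp (B.inverse.comp (hessYX f x y - hessYX f x' y'))) := by
    ext1 v
    simp only [schurH, _root_.sub_apply, _root_.add_apply, ContinuousLinearMap.comp_apply, map_sub,
      ← hAdef, ← hBdef]
    abel
  have c3 : ∀ (S : Rn m →L[ℝ] Rn n) (T : Rn m →L[ℝ] Rn m) (U : Rn n →L[ℝ] Rn m) (a b c : ℝ),
      0 ≤ a → 0 ≤ b → ‖S‖ ≤ a → ‖T‖ ≤ b → ‖U‖ ≤ c → ‖S.comp (T.comp U)‖ ≤ a * (b * c) := by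
    intro S T U a b c ha hb h1 h2 h3
    calc _ ≤ ‖S‖ * (‖T‖ * ‖U‖) :=
          (ContinuousLinearMap.opNorm_comp_le _ _).trans
            (by gcongr; exact ContinuousLinearMap.opNorm_comp_le _ _)
      _ ≤ _ := by gcongr
  have hYX := hA.norm_hessYX_le hℓ x y
  have hXY := hA.norm_hessXY_le hℓ x' y'
  rw [e]
  calc _ ≤ ‖hessXX f x y - hessXX f x' y'‖ + ‖_‖ := norm_sub_le _ _
    _ ≤ ρ * d + (((ρ * d) * (1 / μ * ℓ) + ℓ * (1 / μ * (ρ * d) * (1 / μ) * ℓ))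
          + ℓ * (1 / μ * (ρ * d))) := by
        refine add_le_add (hA.hessXX_lipschitz x y x' y') ?_
        refine (norm_add_le _ _).trans (add_le_add ((norm_add_le _ _).trans (add_le_add ?_ ?_)) ?_)
        · exact c3 _ _ _ _ _ _ (by positivity) (by positivity)
            (hA.hessXY_lipschitz x y x' y') hnA hYX
        · exact c3 _ _ _ _ _ _ (by positivity) (by positivity) hXY hAB hYX
        · exact c3 _ _ _ _ _ _ (by positivity) (by positivity) hXY hnB
            (hA.hessYX_lipschitz x y x' y')
    _ = LH ℓ μ ρ * d := by rw [LH, kappa]; field_simp; ring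

end Assumptions

end Bounds

end GRTR
namespace GRTR

open Set Filter Topology

/-! ### The maximizer map, the derivatives of P, and inner gradient ascent. -/

section Primal

variable {n m : ℕ} {f : Rn n → Rn m → ℝ} {ℓ μ ρ Pstar : ℝ}

local notation "⟪" x ", " y "⟫" => inner ℝ x y

theorem one_le_kappa (hμ : 0 < μ) (h : μ ≤ ℓ) : 1 ≤ kappa ℓ μ := (one_le_div hμ).2 h

theorem kappa_pos (hℓ : 0 < ℓ) (hμ : 0 < μ) : 0 < kappa ℓ μ := div_pos hℓ hμ

theorem L1_pos (hℓ : 0 < ℓ) (hμ : 0 < μ) : 0 < L1 ℓ μ := by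
  have := kappa_pos hℓ hμ
  unfold L1
  positivity

theorem LH_pos (hℓ : 0 < ℓ) (hμ : 0 < μ) (hρ : 0 < ρ) : 0 < LH ℓ μ ρ := by
  have := kappa_pos hℓ hμ
  unfold LH
  positivity

theorem L2_pos (hℓ : 0 < ℓ) (hμ : 0 < μ) (hρ : 0 < ρ) : 0 < L2 ℓ μ ρ := by
  have := kappa_pos hℓ hμ
  unfold L2
  positivity

namespace Assumptions

theorem isMaxOn_yStar (hA : Assumptions f ℓ μ ρ Pstar) (hμ : 0 < μ) (x : Rn n) :
    IsMaxOn (f x) univ (yStar f x) :=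
  Classical.epsilon_spec (exists_isMaxOn_of_strongConcaveOn hμ (hA.strongConcave x)
    fun y => hasFDerivAt_right hA.contDiff x y)

theorem gradY_yStar (hA : Assumptions f ℓ μ ρ Pstar) (hμ : 0 < μ) (x : Rn n) :
    gradY f x (yStar f x) = 0 := by
  have h := (hA.isMaxOn_yStar hμ x).isLocalMax univ_mem
  have h0 := h.hasFDerivAt_eq_zero (hasFDerivAt_right hA.contDiff x (yStar f x))
  rw [← norm_eq_zero, ← innerSL_apply_norm (𝕜 := ℝ), h0, norm_zero]

theorem primal_eq (hA : Assumptions f ℓ μ ρ Pstar) (hμ : 0 < μ) (x : Rn n) :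
    primal f x = f x (yStar f x) := by
  have hmax : ∀ y, f x y ≤ f x (yStar f x) := fun y => hA.isMaxOn_yStar hμ x (mem_univ y)
  exact le_antisymm (ciSup_le hmax)
    (le_ciSup (f := fun y => f x y) ⟨_, forall_mem_range.2 hmax⟩ (yStar f x))

/-- Strong monotonicity of -∇_y f(x, ·) gives μ‖u - v‖ ≤ ‖∇_y f(x, v)‖, and the right side is at
most ℓ‖x - x'‖ because ∇_y f(x', v) = 0. -/
theorem yStar_lipschitz (hA : Assumptions f ℓ μ ρ Pstar) (hμ : 0 < μ) (x x' : Rn n) :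
    ‖yStar f x - yStar f x'‖ ≤ kappa ℓ μ * ‖x - x'‖ := by
  set u := yStar f x with hu
  set v := yStar f x' with hv
  have h1 := hA.inner_gradY_sub_le x u v
  rw [hu, hA.gradY_yStar hμ, ← hu, zero_sub, inner_neg_left] at h1
  have h2 := hA.gradY_lipschitz x x' v v
  rw [hv, hA.gradY_yStar hμ, ← hv, sub_zero, sub_self, pairNorm_zero_right] at h2
  have h3 := real_inner_le_norm (gradY f x v) (u - v)
  have h4 : ‖gradY f x v‖ * ‖u - v‖ ≤ (ℓ * ‖x - x'‖) * ‖u - v‖ := by gcongr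
  rcases (norm_nonneg (u - v)).eq_or_lt with h0 | h0
  · rw [← h0] at h4 h1 ⊢
    by_contra hlt
    push Not at hlt
    rcases (norm_nonneg (x - x')).eq_or_lt with hx | hx
    · rw [← hx] at hlt; simp at hlt
    · have h5 := (norm_nonneg _).trans h2
      have h6 : ℓ * ‖x - x'‖ / μ < 0 := by rwa [kappa, div_mul_eq_mul_div] at hlt
      have h7 : 0 ≤ ℓ * ‖x - x'‖ / μ := by positivity
      linarith
  · have h5 : (μ * ‖u - v‖) * ‖u - v‖ ≤ (ℓ * ‖x - x'‖) * ‖u - v‖ := by nlinarith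
    have h6 := le_of_mul_le_mul_right h5 h0
    rw [kappa, div_mul_eq_mul_div, le_div_iff₀ hμ]
    linarith

theorem continuous_yStar (hA : Assumptions f ℓ μ ρ Pstar) (hℓ : 0 < ℓ) (hμ : 0 < μ) :
    Continuous (yStar f) :=
  (LipschitzWith.of_dist_le_mul (K := ⟨kappa ℓ μ, (kappa_pos hℓ hμ).le⟩) fun x x' => by
    rw [dist_eq_norm, dist_eq_norm]; exact hA.yStar_lipschitz hμ x x').continuous

/-- Implicit differentiation done directly: expand ∇_y f(x', y*(x')) = 0 around (x, y*(x)) and apply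
the inverse of the yy block. The Lipschitz bound on `yStar` turns the remainder into o(x' - x). -/
theorem hasFDerivAt_yStar (hA : Assumptions f ℓ μ ρ Pstar) (hℓ : 0 < ℓ) (hμ : 0 < μ) (x : Rn n) :
    HasFDerivAt (yStar f)
      (-((hessYY f x (yStar f x)).inverse.comp (hessYX f x (yStar f x)))) x := by
  have hi := hA.hessYY_isInvertible hμ x (yStar f x)
  have hG := (hasFDerivAt_gradY hA.contDiff x (yStar f x)).isLittleO
  have hlim : Tendsto (fun x' => (x', yStar f x')) (𝓝 x) (𝓝 (x, yStar f x)) :=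
    (continuous_id.prodMk (hA.continuous_yStar hℓ hμ)).tendsto x
  have h1 := hG.comp_tendsto hlim
  have hO : (fun x' => ((x', yStar f x') : Rn n × Rn m) - (x, yStar f x))
      =O[𝓝 x] fun x' => x' - x := by
    refine Asymptotics.IsBigO.of_bound (max 1 (kappa ℓ μ)) (Eventually.of_forall fun x' => ?_)
    rw [Prod.mk_sub_mk, Prod.norm_def]
    refine max_le ?_ ?_
    · simpa using mul_le_mul_of_nonneg_right (le_max_left 1 (kappa ℓ μ)) (norm_nonneg (x' - x))
    · exact (hA.yStar_lipschitz hμ x' x).trans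
        (mul_le_mul_of_nonneg_right (le_max_right _ _) (norm_nonneg _))
  have h2 := h1.trans_isBigO hO
  have h3 := ((hessYY f x (yStar f x)).inverse.isBigO_comp _ _).trans_isLittleO h2
  rw [hasFDerivAt_iff_isLittleO]
  refine h3.neg_left.congr_left fun x' => ?_
  simp only [Function.comp_def, hA.gradY_yStar hμ, sub_self, zero_sub, map_neg, _root_.add_apply,
    ContinuousLinearMap.comp_apply, Prod.mk_sub_mk, ContinuousLinearMap.coe_fst',
    ContinuousLinearMap.coe_snd', neg_neg, map_add, _root_.neg_apply, hi.inverse_apply_self]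
  abel

/-- Envelope argument: ∇_y f vanishes at y*(x), so the chain rule keeps only the x-derivative. -/
theorem hasFDerivAt_primal (hA : Assumptions f ℓ μ ρ Pstar) (hℓ : 0 < ℓ) (hμ : 0 < μ)
    (x : Rn n) : HasFDerivAt (primal f) (innerSL ℝ (gradX f x (yStar f x))) x := by
  have hP : primal f = (fun p : Rn n × Rn m => f p.1 p.2) ∘ fun x => (x, yStar f x) :=
    funext fun x => hA.primal_eq hμ x
  rw [hP]
  refine (HasFDerivAt.comp (f := fun x => (x, yStar f x)) x
    (hasFDerivAt_uncurry hA.contDiff (x, yStar f x))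
    ((hasFDerivAt_id x).prodMk (hA.hasFDerivAt_yStar hℓ hμ x))).congr_fderiv ?_
  refine ContinuousLinearMap.ext fun v => ?_
  simp [hA.gradY_yStar hμ]

theorem gradient_primal (hA : Assumptions f ℓ μ ρ Pstar) (hℓ : 0 < ℓ) (hμ : 0 < μ) :
    gradient (primal f) = fun x => gradX f x (yStar f x) :=
  funext fun x => (hasGradientAt_iff_hasFDerivAt.2 (hA.hasFDerivAt_primal hℓ hμ x)).gradient

theorem hasFDerivAt_gradX_yStar (hA : Assumptions f ℓ μ ρ Pstar) (hℓ : 0 < ℓ) (hμ : 0 < μ)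
    (x : Rn n) : HasFDerivAt (fun x => gradX f x (yStar f x)) (schurH f x (yStar f x)) x := by
  refine (HasFDerivAt.comp (f := fun x => (x, yStar f x)) x
    (hasFDerivAt_gradX hA.contDiff x (yStar f x))
    ((hasFDerivAt_id x).prodMk (hA.hasFDerivAt_yStar hℓ hμ x))).congr_fderiv ?_
  refine ContinuousLinearMap.ext fun v => ?_
  simp [schurH, sub_eq_add_neg]

theorem pairNorm_yStar_le (hA : Assumptions f ℓ μ ρ Pstar) (hμ : 0 < μ)
    (x x' : Rn n) :
    pairNorm (x - x') (yStar f x - yStar f x') ≤ (1 + kappa ℓ μ) * ‖x - x'‖ := by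
  refine (pairNorm_le_add _ _).trans ?_
  have := hA.yStar_lipschitz hμ x x'
  linarith

theorem gradX_yStar_lipschitz (hA : Assumptions f ℓ μ ρ Pstar) (hℓ : 0 < ℓ) (hμ : 0 < μ)
    (x x' : Rn n) :
    ‖gradX f x (yStar f x) - gradX f x' (yStar f x')‖ ≤ L1 ℓ μ * ‖x - x'‖ := by
  refine (hA.gradX_lipschitz x x' _ _).trans ?_
  calc _ ≤ ℓ * ((1 + kappa ℓ μ) * ‖x - x'‖) := by gcongr; exact hA.pairNorm_yStar_le hμ x x'
    _ = _ := by rw [L1]; ring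

theorem schurH_yStar_lipschitz (hA : Assumptions f ℓ μ ρ Pstar) (hℓ : 0 < ℓ) (hμ : 0 < μ)
    (hρ : 0 < ρ) (x x' : Rn n) :
    ‖schurH f x (yStar f x) - schurH f x' (yStar f x')‖ ≤ L2 ℓ μ ρ * ‖x - x'‖ := by
  refine (hA.schurH_lipschitz hℓ hμ hρ x x' _ _).trans ?_
  have := LH_pos hℓ hμ hρ
  calc _ ≤ LH ℓ μ ρ * ((1 + kappa ℓ μ) * ‖x - x'‖) := by
        gcongr; exact hA.pairNorm_yStar_le hμ x x'
    _ = _ := by rw [L2, LH]; ring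

theorem isSOSP_iff (hA : Assumptions f ℓ μ ρ Pstar) (hℓ : 0 < ℓ) (hμ : 0 < μ) (ξ θ ε : ℝ)
    (x : Rn n) : IsSOSP (primal f) ξ θ ε x ↔ ‖gradX f x (yStar f x)‖ ≤ ξ * ε ∧
      ∀ v, -(θ * √ε) * ‖v‖ ^ 2 ≤ ⟪v, schurH f x (yStar f x) v⟫ := by
  have hH := hA.hasFDerivAt_gradX_yStar hℓ hμ x
  simp only [IsSOSP, hA.gradient_primal hℓ hμ, hH.fderiv]
  exact ⟨fun h => h.2.2, fun h => ⟨Eventually.of_forall fun x' =>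
    (hA.hasFDerivAt_primal hℓ hμ x').differentiableAt, hH.differentiableAt, h⟩⟩

/-! ### Gradient ascent in the second variable -/

/-- The Jacobian I + η∇²_yy f is symmetric with spectrum in [1 - ηℓ, 1 - ημ]; for η = 2/(ℓ+μ) this
interval is symmetric about 0 with radius (ℓ-μ)/(ℓ+μ). -/
theorem ascent_contraction (hA : Assumptions f ℓ μ ρ Pstar) (hℓ : 0 < ℓ) (hμ : 0 < μ)
    (hμℓ : μ ≤ ℓ) (x : Rn n) (z z' : Rn m) :
    ‖(z + (2 / (ℓ + μ)) • gradY f x z) - (z' + (2 / (ℓ + μ)) • gradY f x z')‖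
      ≤ (ℓ - μ) / (ℓ + μ) * ‖z - z'‖ := by
  have hd : ∀ z, HasFDerivAt (fun z => z + (2 / (ℓ + μ)) • gradY f x z)
      (ContinuousLinearMap.id ℝ (Rn m) + (2 / (ℓ + μ)) • hessYY f x z) z := fun z =>
    (hasFDerivAt_id z).fun_add ((hasFDerivAt_gradY_right hA.contDiff x z).fun_const_smul _)
  have hq : 0 ≤ (ℓ - μ) / (ℓ + μ) := div_nonneg (by linarith) (by linarith)
  refine Convex.norm_image_sub_le_of_norm_hasFDerivWithin_le
    (fun z _ => (hd z).hasFDerivWithinAt) (fun w _ => ?_) convex_univ (mem_univ z') (mem_univ z)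
  refine ContinuousLinearMap.opNorm_le_bound _ hq
    (norm_apply_le_of_abs_inner_le (fun u v => ?_) fun v => ?_)
  · simp only [_root_.add_apply, _root_.smul_apply, ContinuousLinearMap.id_apply, inner_add_left,
      inner_add_right, real_inner_smul_left, real_inner_smul_right]
    rw [hessYY_symm hA.contDiff]
  · have h1 := hA.inner_hessYY_le x w v
    have h2 := (abs_le.1 (abs_real_inner_le_norm v (hessYY f x w v))).1
    have h3 := (hessYY f x w).le_of_opNorm_le (hA.norm_hessYY_le hℓ x w) v
    have h4 : ‖v‖ * ‖hessYY f x w v‖ ≤ ‖v‖ * (ℓ * ‖v‖) := by gcongr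
    simp only [_root_.add_apply, _root_.smul_apply, ContinuousLinearMap.id_apply,
      inner_add_right, real_inner_smul_right, real_inner_self_eq_norm_sq]
    have hs : 0 < ℓ + μ := by linarith
    have e : ‖v‖ ^ 2 + 2 / (ℓ + μ) * ⟪v, hessYY f x w v⟫
        = ((ℓ + μ) * ‖v‖ ^ 2 + 2 * ⟪v, hessYY f x w v⟫) / (ℓ + μ) := by field_simp
    rw [e, div_mul_eq_mul_div, abs_le, ← neg_div]
    constructor
    · gcongr
      nlinarith
    · gcongr
      nlinarith

theorem norm_ascent_iterate_sub_le (hA : Assumptions f ℓ μ ρ Pstar) (hℓ : 0 < ℓ) (hμ : 0 < μ)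
    (hμℓ : μ ≤ ℓ) (x : Rn n) (z : Rn m) (k : ℕ) :
    ‖(fun z => z + (2 / (ℓ + μ)) • gradY f x z)^[k] z - yStar f x‖
      ≤ Real.exp (-(k / kappa ℓ μ)) * ‖z - yStar f x‖ := by
  have hκ := kappa_pos hℓ hμ
  have hκ1 := one_le_kappa hμ hμℓ
  -- Through 1 - μ/ℓ, which lies between the two sides.
  have hq : (ℓ - μ) / (ℓ + μ) ≤ Real.exp (-(1 / kappa ℓ μ)) := by
    refine le_trans ?_ (Real.add_one_le_exp _)
    rw [kappa, one_div_div, div_le_iff₀ (by linarith)]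
    have : -(μ / ℓ) + 1 = (ℓ - μ) / ℓ := by field_simp; ring
    rw [this, div_mul_eq_mul_div, le_div_iff₀ hℓ]
    nlinarith
  induction k with
  | zero => simp
  | succ k ih =>
    rw [Function.iterate_succ_apply']
    have h := hA.ascent_contraction hℓ hμ hμℓ x
      ((fun z => z + (2 / (ℓ + μ)) • gradY f x z)^[k] z) (yStar f x)
    rw [hA.gradY_yStar hμ, smul_zero, add_zero] at h
    refine h.trans ?_
    calc _ ≤ Real.exp (-(1 / kappa ℓ μ))
          * (Real.exp (-(k / kappa ℓ μ)) * ‖z - yStar f x‖) := by gcongr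
      _ = _ := by
        rw [← mul_assoc, ← Real.exp_add]
        congr 2
        push_cast
        ring

/-- Enough ascent steps bring the inner iterate within distance `a` of the maximizer. -/
theorem norm_ascent_iterate_sub_le_of_log_le (hA : Assumptions f ℓ μ ρ Pstar) (hℓ : 0 < ℓ)
    (hμ : 0 < μ) (hμℓ : μ ≤ ℓ) {x : Rn n} {z : Rn m} {k : ℕ} {a d : ℝ} (ha : 0 < a)
    (hd : ‖z - yStar f x‖ ≤ d) (hk : kappa ℓ μ * Real.log (d / a) ≤ k) :
    ‖(fun z => z + (2 / (ℓ + μ)) • gradY f x z)^[k] z - yStar f x‖ ≤ a := by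
  refine (hA.norm_ascent_iterate_sub_le hℓ hμ hμℓ x z k).trans ?_
  have hκ := kappa_pos hℓ hμ
  rcases ((norm_nonneg _).trans hd).eq_or_lt with h0 | h0
  · have : ‖z - yStar f x‖ = 0 := le_antisymm (by rw [h0]; exact hd) (norm_nonneg _)
    rw [this, mul_zero]
    exact ha.le
  · have h1 : Real.exp (-(k / kappa ℓ μ)) ≤ a / d := by
      rw [← Real.le_log_iff_exp_le (by positivity), ← inv_div d a, Real.log_inv, neg_le_neg_iff,
        le_div_iff₀ hκ]
      linarith
    calc _ ≤ a / d * d := by gcongr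
      _ = a := by field_simp

end Assumptions

end Primal

end GRTR
namespace GRTR

open Set Filter Topology

/-! ### One inexact trust region step with M = √L₂, and the counting argument. -/

section Step

variable {n : ℕ}

local notation "⟪" x ", " y "⟫" => inner ℝ x y

/-- `s` solves the trust region subproblem at `x` for an inexact gradient `g` and an inexact
Hessian `H` of a function with gradient `G` and Hessian `G'`. -/
structure InexactStep (G : Rn n → Rn n) (G' : Rn n → Rn n →L[ℝ] Rn n) (M L ε : ℝ)
    (x g : Rn n) (H : Rn n →L[ℝ] Rn n) (s : Rn n) : Prop where
  grad_err : ‖g - G x‖ ≤ ε * √ε / 96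
  grad_err_mul : L * ‖g - G x‖ ≤ M * (ε * √ε) / 16
  hess_err : ‖H - G' x‖ ≤ M * √ε / 12
  symm : ∀ u v, ⟪H u, v⟫ = ⟪u, H v⟫
  norm_le : ‖H‖ ≤ L
  feasible : ‖s‖ ≤ 1 / (4 * M) * max (√‖g‖) (√ε)
  optimal : ∀ s', ‖s'‖ ≤ 1 / (4 * M) * max (√‖g‖) (√ε) → model g H (M / 2) s ≤ model g H (M / 2) s'

theorem model_eq (g : Rn n) (H : Rn n →L[ℝ] Rn n) (σ : ℝ) (s : Rn n) :
    model g H σ s = ⟪g, s⟫ + 1 / 2 * ⟪s, (H + (σ * √‖g‖) • ContinuousLinearMap.id ℝ (Rn n)) s⟫ := by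
  simp [model]

namespace InexactStep

variable {φ : Rn n → ℝ} {G : Rn n → Rn n} {G' : Rn n → Rn n →L[ℝ] Rn n} {M L ε : ℝ}
  {x g s : Rn n} {H : Rn n →L[ℝ] Rn n}

theorem symm_shift (h : InexactStep G G' M L ε x g H s) (u v : Rn n) :
    ⟪(H + (M / 2 * √‖g‖) • ContinuousLinearMap.id ℝ (Rn n)) u, v⟫
      = ⟪u, (H + (M / 2 * √‖g‖) • ContinuousLinearMap.id ℝ (Rn n)) v⟫ := by
  simp only [_root_.add_apply, _root_.smul_apply, ContinuousLinearMap.id_apply, inner_add_left,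
      inner_add_right, real_inner_smul_left, real_inner_smul_right, h.symm]

theorem optimal_shift (h : InexactStep G G' M L ε x g H s) (s' : Rn n)
    (hs' : ‖s'‖ ≤ 1 / (4 * M) * max (√‖g‖) (√ε)) :
    ⟪g, s⟫ + 1 / 2 * ⟪s, (H + (M / 2 * √‖g‖) • ContinuousLinearMap.id ℝ (Rn n)) s⟫
      ≤ ⟪g, s'⟫ + 1 / 2 * ⟪s', (H + (M / 2 * √‖g‖) • ContinuousLinearMap.id ℝ (Rn n)) s'⟫ := by
  rw [← model_eq, ← model_eq]
  exact h.optimal s' hs'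

theorem model_nonpos (h : InexactStep G G' M L ε x g H s) (hM : 0 < M) :
    model g H (M / 2) s ≤ 0 := by
  have := h.optimal 0 (by rw [norm_zero]; positivity)
  simpa [model] using this

/-- The cubic Taylor bound with the exact derivatives replaced by g and H. The model contains the
regularizer M/4 √‖g‖ ‖s‖², absent from φ, so that amount is gained and pays for the errors. -/
theorem value_le (h : InexactStep G G' M L ε x g H s)
    (hφ : ∀ x, HasFDerivAt φ (innerSL ℝ (G x)) x) (hG : ∀ x, HasFDerivAt G (G' x) x)
    (hL : ∀ x y, ‖G' x - G' y‖ ≤ M ^ 2 * ‖x - y‖) :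
    φ (x + s) ≤ φ x + model g H (M / 2) s - M / 4 * √‖g‖ * ‖s‖ ^ 2 + ‖g - G x‖ * ‖s‖
      + M * √ε / 24 * ‖s‖ ^ 2 + M ^ 2 / 6 * ‖s‖ ^ 3 := by
  have h1 := (abs_le.1 (abs_sub_quadratic_le hφ hG hL x s)).2
  have h2 := (abs_le.1 (abs_real_inner_le_norm (g - G x) s)).1
  have h3 := (abs_le.1 (abs_real_inner_le_norm s ((H - G' x) s))).1
  have h4 := (H - G' x).le_of_opNorm_le h.hess_err s
  have h5 : ‖s‖ * ‖(H - G' x) s‖ ≤ ‖s‖ * (M * √ε / 12 * ‖s‖) := by gcongr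
  rw [inner_sub_left] at h2
  rw [_root_.sub_apply, inner_sub_right] at h3
  have h6 : model g H (M / 2) s = ⟪g, s⟫ + 1 / 2 * ⟪s, H s⟫ + M / 4 * √‖g‖ * ‖s‖ ^ 2 := by
    rw [model, inner_add_right, real_inner_smul_right, real_inner_self_eq_norm_sq]; ring
  rw [h6]
  rw [_root_.sub_apply] at h5
  nlinarith

/-- Decrease at a boundary solution with large gradient. -/
theorem value_le_of_boundary (h : InexactStep G G' M L ε x g H s)
    (hφ : ∀ x, HasFDerivAt φ (innerSL ℝ (G x)) x) (hG : ∀ x, HasFDerivAt G (G' x) x)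
    (hL : ∀ x y, ‖G' x - G' y‖ ≤ M ^ 2 * ‖x - y‖) (hM : 0 < M) (hε : 0 < ε) (hε4 : ε ≤ 1 / 4)
    (hg : ε ≤ ‖g‖) (hs : 1 / (4 * M) * max (√‖g‖) (√ε) ≤ ‖s‖) :
    φ (x + s) ≤ φ x - 7 / 6 * (ε * √ε) / (128 * M) := by
  have h1 := h.value_le hφ hG hL
  have h2 := h.model_nonpos hM
  have h3 := h.grad_err
  have hqw : √ε ≤ √‖g‖ := Real.sqrt_le_sqrt hg
  have hse := le_antisymm h.feasible hs
  rw [max_eq_left hqw] at hse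
  have hq2 : √ε ^ 2 = ε := Real.sq_sqrt hε.le
  have hq : 0 < √ε := Real.sqrt_pos.2 hε
  set q := √ε with hqdef
  set w := √‖g‖ with hwdef
  set k := ‖s‖ with hk
  have hk0 : 0 ≤ k := norm_nonneg _
  have hw : w = 4 * M * k := by rw [hse]; field_simp
  -- Here ε ≤ 1/4 pays off: it halves the gradient error, so in units of M²k³ the change is at most
  -- -1 + 1/12 + 1/6 + 1/6 = -7/12 instead of -1/2. This is the source of the factor 7/6.
  have hq_half : q ≤ 1 / 2 := by nlinarith
  rw [← hq2] at h3 ⊢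
  have e1 : ‖g - G x‖ * k ≤ (q ^ 2 * q / 96) * k := by gcongr
  have e2 : q ^ 2 * q ≤ w ^ 2 * (1 / 2) := by gcongr
  have e3 : q ^ 2 * q * k ≤ w ^ 2 * (1 / 2) * k := by gcongr
  have e4 : M * q / 24 * k ^ 2 ≤ M * w / 24 * k ^ 2 := by gcongr
  have e5 : q ^ 2 * q ≤ w ^ 2 * w := by gcongr
  have e6 : φ (x + s) ≤ φ x - 7 / 12 * (M ^ 2 * k ^ 3) := by
    rw [hw] at e3 e4 h1
    nlinarith
  have e7 : 7 / 6 * (q ^ 2 * q) / (128 * M) ≤ 7 / 12 * (M ^ 2 * k ^ 3) := by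
    rw [div_le_iff₀ (by positivity)]
    rw [hw] at e5
    nlinarith
  linarith

/-- Decrease at a point with small gradient and significant negative curvature. -/
theorem value_le_of_negative_curvature (h : InexactStep G G' M L ε x g H s)
    (hφ : ∀ x, HasFDerivAt φ (innerSL ℝ (G x)) x) (hG : ∀ x, HasFDerivAt G (G' x) x)
    (hL : ∀ x y, ‖G' x - G' y‖ ≤ M ^ 2 * ‖x - y‖) (hM : 0 < M) (hε : 0 < ε) (hε1 : ε ≤ 1)
    (hg : ‖g‖ ≤ ε) (hneg : ¬ ∀ v, -(19 / 12 * M * √ε) * ‖v‖ ^ 2 ≤ ⟪v, G' x v⟫) :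
    φ (x + s) ≤ φ x - 7 / 6 * (ε * √ε) / (128 * M) := by
  have h1 := h.value_le hφ hG hL
  have h3 := h.grad_err
  have hqw : √‖g‖ ≤ √ε := Real.sqrt_le_sqrt hg
  have hq2 : √ε ^ 2 = ε := Real.sq_sqrt hε.le
  have hq : 0 < √ε := Real.sqrt_pos.2 hε
  have hw0 : 0 ≤ √‖g‖ := Real.sqrt_nonneg _
  obtain ⟨lam, hlam, hgs, hpsd, hint⟩ := exists_multiplier h.symm_shift
    (R := 1 / (4 * M) * max (√‖g‖) (√ε)) (by rw [max_eq_right hqw]; positivity) h.feasible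
    h.optimal_shift
  -- A smaller multiplier would bound the curvature below by -(1 + 1/2 + 1/12) M√ε: multiplier,
  -- regularizer and Hessian error. The sum is 19/12.
  have hlam' : M * √ε < lam := by
    by_contra hle
    push Not at hle
    refine hneg fun v => ?_
    have h5 := hpsd v
    simp only [_root_.add_apply, _root_.smul_apply, ContinuousLinearMap.id_apply,
      inner_add_right, real_inner_smul_right, real_inner_self_eq_norm_sq] at h5
    have h6 := (abs_le.1 (abs_real_inner_le_norm v ((H - G' x) v))).2
    have h7 := (H - G' x).le_of_opNorm_le h.hess_err v
    have h8 : ‖v‖ * ‖(H - G' x) v‖ ≤ ‖v‖ * (M * √ε / 12 * ‖v‖) := by gcongr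
    rw [_root_.sub_apply] at h8 h6
    rw [inner_sub_right] at h6
    have h9 : lam * ‖v‖ ^ 2 ≤ M * √ε * ‖v‖ ^ 2 := by gcongr
    have h10 : M / 2 * √‖g‖ * ‖v‖ ^ 2 ≤ M / 2 * √ε * ‖v‖ ^ 2 := by gcongr
    nlinarith
  have hmodel : model g H (M / 2) s ≤ -(1 / 2) * (M * √ε) * ‖s‖ ^ 2 := by
    have h5 := hpsd s
    rw [model_eq]
    set B := H + (M / 2 * √‖g‖) • ContinuousLinearMap.id ℝ (Rn n)
    have h6 : ⟪g, s⟫ = -lam * ‖s‖ ^ 2 - ⟪s, B s⟫ := by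
      have : g = -(lam • s) - B s := eq_sub_of_add_eq hgs
      rw [this, inner_sub_left, inner_neg_left, real_inner_smul_left, real_inner_self_eq_norm_sq,
        real_inner_comm]
      ring
    have h7 : M * √ε * ‖s‖ ^ 2 ≤ lam * ‖s‖ ^ 2 := by gcongr
    rw [h6]
    linarith
  have hse : ‖s‖ = 1 / (4 * M) * max (√‖g‖) (√ε) := by
    refine h.feasible.lt_or_eq.resolve_left fun hlt => ?_
    have := hint hlt
    have : 0 < M * √ε := by positivity
    linarith
  rw [max_eq_right hqw] at hse
  set q := √ε with hqdef
  set w := √‖g‖ with hwdef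
  set k := ‖s‖ with hk
  have hk0 : 0 ≤ k := norm_nonneg _
  have hqk : q = 4 * M * k := by rw [hse]; field_simp
  have hq1 : q ≤ 1 := by nlinarith
  rw [← hq2] at h3 ⊢
  have e1 : ‖g - G x‖ * k ≤ (q ^ 2 * q / 96) * k := by gcongr
  have e3 : q ^ 2 * q * k ≤ q ^ 2 * 1 * k := by gcongr
  have e4 : 0 ≤ M / 4 * w * k ^ 2 := by positivity
  -- In units of M²k³ the model contributes -2, and the gradient, Hessian and Taylor errors 1/6
  -- each.
  have e6 : φ (x + s) ≤ φ x - 3 / 2 * (M ^ 2 * k ^ 3) := by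
    have e8 : q ^ 2 * q * k ≤ 16 * (M ^ 2 * k ^ 3) := by
      refine e3.trans_eq ?_
      rw [hqk]; ring
    have e9 : -(1 / 2) * (M * q) * k ^ 2 = -2 * (M ^ 2 * k ^ 3) := by rw [hqk]; ring
    have e10 : M * q / 24 * k ^ 2 = 1 / 6 * (M ^ 2 * k ^ 3) := by rw [hqk]; ring
    linarith
  have e7 : 7 / 6 * (q ^ 2 * q) / (128 * M) ≤ 3 / 2 * (M ^ 2 * k ^ 3) := by
    rw [div_le_iff₀ (by positivity), hqk]
    have : 0 ≤ M ^ 3 * k ^ 3 := by positivity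
    nlinarith
  linarith

/-- At an interior solution with large gradient the value does not increase. -/
theorem value_le_of_interior (h : InexactStep G G' M L ε x g H s)
    (hφ : ∀ x, HasFDerivAt φ (innerSL ℝ (G x)) x) (hG : ∀ x, HasFDerivAt G (G' x) x)
    (hL : ∀ x y, ‖G' x - G' y‖ ≤ M ^ 2 * ‖x - y‖) (hM : 0 < M) (hL0 : 0 < L) (hε : 0 < ε)
    (hε1 : ε ≤ 1) (hg : ε ≤ ‖g‖) (hs : ‖s‖ < 1 / (4 * M) * max (√‖g‖) (√ε)) :
    φ (x + s) ≤ φ x := by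
  have h1 := h.value_le hφ hG hL
  have h2 := h.model_nonpos hM
  have h3 := h.grad_err
  have h4 := h.grad_err_mul
  have hqw : √ε ≤ √‖g‖ := Real.sqrt_le_sqrt hg
  have hq2 : √ε ^ 2 = ε := Real.sq_sqrt hε.le
  have hw2 : √‖g‖ ^ 2 = ‖g‖ := Real.sq_sqrt (norm_nonneg _)
  have hq : 0 < √ε := Real.sqrt_pos.2 hε
  have h0 := grad_eq_zero_of_interior h.symm_shift hs h.optimal_shift
  rw [max_eq_left hqw] at hs
  -- The Newton equation bounds the step length from below, so that the gradient error can be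
  -- charged to the regularizer.
  have hgn : ‖g‖ ≤ (L + M / 2 * √‖g‖) * ‖s‖ := by
    rw [_root_.add_apply, _root_.smul_apply, ContinuousLinearMap.id_apply] at h0
    have : g = -(H s + (M / 2 * √‖g‖) • s) := eq_neg_of_add_eq_zero_left h0
    calc ‖g‖ = ‖H s + (M / 2 * √‖g‖) • s‖ := by
          conv_lhs => rw [this, norm_neg]
      _ ≤ ‖H s‖ + ‖(M / 2 * √‖g‖) • s‖ := norm_add_le _ _
      _ ≤ L * ‖s‖ + (M / 2 * √‖g‖) * ‖s‖ := by
          refine add_le_add (H.le_of_opNorm_le h.norm_le s) ?_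
          rw [norm_smul, Real.norm_of_nonneg (by positivity)]
      _ = _ := by ring
  set q := √ε with hqdef
  set w := √‖g‖ with hwdef
  set k := ‖s‖ with hk
  set e := ‖g - G x‖ with he
  have hk0 : 0 ≤ k := norm_nonneg _
  have hw : 0 < w := hq.trans_le hqw
  have hq1 : q ≤ 1 := by nlinarith
  have hMk : M * k ≤ w / 4 := by
    have : M * k ≤ M * (1 / (4 * M) * w) := by gcongr
    refine this.trans_eq ?_
    field_simp
  rw [← hq2] at h3 h4
  rw [← hw2] at hgn
  have q1 : q ^ 2 * q ≤ w ^ 2 * w := by gcongr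
  have q2 : q ^ 2 * q ≤ w ^ 2 * 1 := by gcongr
  -- Compare after multiplying by L + M w/2. The L part needs `grad_err_mul`, which is why ε₁
  -- contains √L₂/(16 L₁).
  have hekey : e ≤ M * w * k / 6 := by
    have hpos : 0 < L + M / 2 * w := by positivity
    refine le_of_mul_le_mul_left ?_ hpos
    have a1 : M * (q ^ 2 * q) ≤ M * (w ^ 2 * w) := by gcongr
    have a2 : M / 2 * w * e ≤ M / 2 * w * (w ^ 2 * 1 / 96) := by
      gcongr; exact h3.trans (by gcongr)
    have a3 : M * w / 6 * w ^ 2 ≤ M * w / 6 * ((L + M / 2 * w) * k) := by gcongr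
    have a4 : 0 ≤ M * w ^ 3 := by positivity
    nlinarith
  have b1 : M * q / 24 * k ^ 2 ≤ M * w / 24 * k ^ 2 := by gcongr
  have b2 : (M * k) * (M / 6 * k ^ 2) ≤ (w / 4) * (M / 6 * k ^ 2) := by gcongr
  have b3 : e * k ≤ M * w * k / 6 * k := by gcongr
  -- In units of M w k² the terms are -1/4 + 1/6 + 1/24 + 1/24 = 0, with no slack.
  nlinarith

/-- At an interior solution with large gradient the gradient shrinks. -/
theorem norm_grad_le_of_interior (h : InexactStep G G' M L ε x g H s)
    (hG : ∀ x, HasFDerivAt G (G' x) x)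
    (hL : ∀ x y, ‖G' x - G' y‖ ≤ M ^ 2 * ‖x - y‖) (hM : 0 < M) (hε : 0 < ε)
    (hε1 : ε ≤ 1) (hg : ε ≤ ‖g‖) (hs : ‖s‖ < 1 / (4 * M) * max (√‖g‖) (√ε)) :
    ‖G (x + s)‖ ≤ 18 / 96 * ‖g‖ := by
  have h3 := h.grad_err
  have hqw : √ε ≤ √‖g‖ := Real.sqrt_le_sqrt hg
  have hq2 : √ε ^ 2 = ε := Real.sq_sqrt hε.le
  have hw2 : √‖g‖ ^ 2 = ‖g‖ := Real.sq_sqrt (norm_nonneg _)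
  have hq : 0 < √ε := Real.sqrt_pos.2 hε
  have h0 := grad_eq_zero_of_interior h.symm_shift hs h.optimal_shift
  rw [max_eq_left hqw] at hs
  have hsum : ‖G (x + s)‖ ≤ M ^ 2 / 2 * ‖s‖ ^ 2 + ε * √ε / 96 + M * √ε / 12 * ‖s‖
      + M / 2 * √‖g‖ * ‖s‖ := by
    have e : G (x + s) = (G (x + s) - G x - G' x s) - (g - G x) - (H - G' x) s
        + (g + (H + (M / 2 * √‖g‖) • ContinuousLinearMap.id ℝ (Rn n)) s)
        - (M / 2 * √‖g‖) • s := by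
      simp only [_root_.add_apply, _root_.sub_apply, _root_.smul_apply,
        ContinuousLinearMap.id_apply]
      abel
    rw [e, h0, add_zero]
    refine (norm_sub_le _ _).trans (add_le_add ((norm_sub_le _ _).trans (add_le_add
      ((norm_sub_le _ _).trans (add_le_add (norm_sub_sub_fderiv_le hG hL x s) h3))
      ((H - G' x).le_of_opNorm_le h.hess_err s))) ?_)
    rw [norm_smul, Real.norm_of_nonneg (by positivity)]
  set q := √ε with hqdef
  set w := √‖g‖ with hwdef
  set k := ‖s‖ with hk
  have hk0 : 0 ≤ k := norm_nonneg _
  have hw : 0 < w := hq.trans_le hqw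
  have hq1 : q ≤ 1 := by nlinarith
  have hMk : M * k ≤ w / 4 := by
    have : M * k ≤ M * (1 / (4 * M) * w) := by gcongr
    refine this.trans_eq ?_
    field_simp
  rw [← hq2] at hsum
  rw [← hw2]
  have q2 : q ^ 2 * q ≤ w ^ 2 * 1 := by gcongr
  have b1 : (M * k) ^ 2 ≤ (w / 4) ^ 2 := by gcongr
  have b2 : q * (M * k) ≤ w * (w / 4) := by gcongr
  have b3 : w * (M * k) ≤ w * (w / 4) := by gcongr
  -- In units of w²/96: Taylor 3, gradient error 1, Hessian error 2, regularizer 12.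
  nlinarith

/-- Away from second-order stationarity, either the value decreases, or the gradient shrinks
without increase of the value. -/
theorem decrease_or_shrink (h : InexactStep G G' M L ε x g H s)
    (hφ : ∀ x, HasFDerivAt φ (innerSL ℝ (G x)) x) (hG : ∀ x, HasFDerivAt G (G' x) x)
    (hL : ∀ x y, ‖G' x - G' y‖ ≤ M ^ 2 * ‖x - y‖) (hM : 0 < M) (hL0 : 0 < L) (hε : 0 < ε)
    (hε4 : ε ≤ 1 / 4)
    (hns : ¬ (‖G x‖ ≤ 97 / 96 * ε ∧ ∀ v, -(19 / 12 * M * √ε) * ‖v‖ ^ 2 ≤ ⟪v, G' x v⟫)) :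
    φ (x + s) ≤ φ x - 7 / 6 * (ε * √ε) / (128 * M) ∨
      (φ (x + s) ≤ φ x ∧ ε < ‖g‖ ∧ ‖G (x + s)‖ ≤ 18 / 96 * ‖g‖) := by
  have hε1 : ε ≤ 1 := hε4.trans (by norm_num)
  rcases le_or_gt ‖g‖ ε with hg | hg
  · left
    refine h.value_le_of_negative_curvature hφ hG hL hM hε hε1 hg fun hv => hns ⟨?_, hv⟩
    have h1 : ‖G x‖ ≤ ‖g‖ + ‖g - G x‖ := by
      have := norm_sub_le g (g - G x)
      rwa [sub_sub_cancel] at this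
    have h2 : √ε ≤ 1 := Real.sqrt_le_one.2 hε1
    have h3 := h.grad_err
    nlinarith
  · rcases lt_or_ge ‖s‖ (1 / (4 * M) * max (√‖g‖) (√ε)) with hs | hs
    · exact Or.inr ⟨h.value_le_of_interior hφ hG hL hM hL0 hε hε1 hg.le hs, hg,
        h.norm_grad_le_of_interior hG hL hM hε hε1 hg.le hs⟩
    · exact Or.inl (h.value_le_of_boundary hφ hG hL hM hε hε4 hg.le hs)

end InexactStep

/-- Counting steps: each step decreases `p` by `d` or divides `γ > ε` by three. -/
theorem exists_count {p γ : ℕ → ℝ} {d ε Γ : ℝ} {F N : ℕ} (hd : 0 ≤ d)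
    (hstep : ∀ t, 1 ≤ t → t ≤ N → p (t + 1) ≤ p t - d ∨
      (p (t + 1) ≤ p t ∧ ε < γ t ∧ γ (t + 1) ≤ γ t / 3))
    (hΓ : ∀ t, 1 ≤ t → p t ≤ p 1 → γ t ≤ Γ)
    (hF : ∀ j : ℕ, 3 ^ j * ε < Γ → j + 1 ≤ F) :
    ∃ K j : ℕ, N ≤ (F + 1) * K + j ∧ j ≤ F ∧ p (N + 1) ≤ p 1 - K * d ∧
      3 ^ j * γ (N + 1) ≤ Γ := by
  -- K counts the decreasing steps and j the shrinking steps since the last of them; the bound on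
  -- 3^j γ is carried for the induction.
  induction N with
  | zero => exact ⟨0, 0, by simp, by simp, by simp, by simpa using hΓ 1 le_rfl le_rfl⟩
  | succ N ih =>
    obtain ⟨K, j, h1, h2, h3, h4⟩ := ih fun t ht htN => hstep t ht (by omega)
    have hKd : 0 ≤ K * d := by positivity
    rcases hstep (N + 1) (by omega) le_rfl with h | ⟨h5, h6, h7⟩
    · have h8 : p (N + 1 + 1) ≤ p 1 - (K + 1 : ℕ) * d := by push_cast; linarith
      refine ⟨K + 1, 0, by ring_nf at h1 ⊢; omega, by simp, h8, ?_⟩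
      simpa using hΓ _ (by omega) (by linarith)
    · have h8 : (3 : ℝ) ^ j * ε < Γ := lt_of_lt_of_le (by gcongr) h4
      refine ⟨K, j + 1, by omega, hF j h8, by linarith, ?_⟩
      calc (3 : ℝ) ^ (j + 1) * γ (N + 1 + 1) ≤ 3 ^ (j + 1) * (γ (N + 1) / 3) := by gcongr
        _ = 3 ^ j * γ (N + 1) := by ring
        _ ≤ Γ := h4

end Step

end GRTR
namespace GRTR

open Set Filter Topology

/-! ### Inequalities between the constants, and the threshold for ε. -/

section Constants

variable {ℓ μ ρ Δ ε : ℝ}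

theorem rpow_three_halves (hε : 0 ≤ ε) : ε ^ (3 / 2 : ℝ) = ε * √ε := by
  rw [show (3 / 2 : ℝ) = 1 + 1 / 2 by norm_num, Real.rpow_add_of_nonneg hε (by norm_num)
    (by norm_num), Real.rpow_one, Real.sqrt_eq_rpow]

theorem rpow_neg_three_halves (hε : 0 ≤ ε) : ε ^ (-(3 / 2) : ℝ) = (ε * √ε)⁻¹ := by
  rw [Real.rpow_neg hε, rpow_three_halves hε]

theorem accA_pos (hℓ : 0 < ℓ) (hμ : 0 < μ) (hρ : 0 < ρ) (hε : 0 < ε) : 0 < accA ℓ μ ρ ε := by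
  have h1 := L1_pos hℓ hμ
  have h2 := LH_pos hℓ hμ hρ
  have h3 := Real.sqrt_pos.2 (L2_pos hℓ hμ hρ)
  unfold accA eps1 eps2
  refine lt_min (div_pos (mul_pos (lt_min ?_ ?_) ?_) hℓ) ?_ <;> positivity

theorem mul_accA_le_eps1 (hℓ : 0 < ℓ) : ℓ * accA ℓ μ ρ ε ≤ eps1 ℓ μ ρ ε := by
  rw [mul_comm, ← le_div_iff₀ hℓ]
  exact min_le_left _ _

theorem mul_accA_le_eps2 (hH : 0 < LH ℓ μ ρ) : LH ℓ μ ρ * accA ℓ μ ρ ε ≤ eps2 ℓ μ ρ ε := by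
  rw [mul_comm, ← le_div_iff₀ hH]
  exact min_le_right _ _

theorem eps1_le (hε : 0 < ε) : eps1 ℓ μ ρ ε ≤ ε * √ε / 96 := by
  rw [eps1, rpow_three_halves hε.le]
  calc _ ≤ 1 / 96 * (ε * √ε) := by gcongr; exact min_le_left _ _
    _ = _ := by ring

theorem L1_mul_eps1_le (hℓ : 0 < ℓ) (hμ : 0 < μ) (hε : 0 < ε) :
    L1 ℓ μ * eps1 ℓ μ ρ ε ≤ √(L2 ℓ μ ρ) * (ε * √ε) / 16 := by
  have h1 := L1_pos hℓ hμ
  rw [eps1, rpow_three_halves hε.le]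
  calc _ ≤ L1 ℓ μ * (√(L2 ℓ μ ρ) / (16 * L1 ℓ μ) * (ε * √ε)) := by
        gcongr; exact min_le_right _ _
    _ = _ := by field_simp

theorem two_le_constG (hℓ : 0 < ℓ) (hμ : 0 < μ) : 2 ≤ constG ℓ μ ρ Δ := by
  have h1 := L1_pos hℓ hμ
  refine le_trans ?_ (le_max_right _ _)
  have : 0 ≤ L1 ℓ μ / (4 * √(L2 ℓ μ ρ)) := by positivity
  linarith

theorem logFactor_eq (hℓ : 0 < ℓ) (hμ : 0 < μ) (hε : 0 < ε) (hε1 : ε ≤ 1) :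
    logFactor ℓ μ ρ Δ ε = (⌈Real.log (constG ℓ μ ρ Δ / ε) / Real.log 3⌉₊ : ℝ) + 1 := by
  have h2 := two_le_constG (ρ := ρ) (Δ := Δ) hℓ hμ
  have h : 0 ≤ Real.log (constG ℓ μ ρ Δ / ε) / Real.log 3 := by
    refine div_nonneg (Real.log_nonneg ?_) (Real.log_nonneg (by norm_num))
    rw [one_le_div hε]
    linarith
  rw [logFactor, natCast_ceil_eq_intCast_ceil h]

theorem add_one_le_ceil_log {G : ℝ} (hε : 0 < ε) (j : ℕ) (h : 3 ^ j * ε < G) :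
    j + 1 ≤ ⌈Real.log (G / ε) / Real.log 3⌉₊ := by
  rw [Nat.add_one_le_ceil_iff, lt_div_iff₀ (Real.log_pos (by norm_num)), ← Real.log_pow]
  exact Real.log_lt_log (by positivity) ((lt_div_iff₀ hε).2 h)

/-- A gradient bound obtained from the function value gap is at most `G - 2`. -/
theorem le_constG_of_sq_le (hℓ : 0 < ℓ) (hμ : 0 < μ) (hρ : 0 < ρ) (hΔ : 0 ≤ Δ) {b : ℝ}
    (hb : b ^ 2 ≤ 2 * L1 ℓ μ * Δ) : b + 2 ≤ constG ℓ μ ρ Δ := by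
  have h1 := L1_pos hℓ hμ
  have h3 := Real.sqrt_pos.2 (L2_pos hℓ hμ hρ)
  refine le_trans ?_ (le_max_left _ _)
  have hC0 : 0 ≤ constC ℓ μ ρ Δ := by unfold constC; positivity
  have hC : constC ℓ μ ρ Δ * √(constC ℓ μ ρ Δ) = 128 * √(L2 ℓ μ ρ) * Δ := by
    rw [← rpow_three_halves hC0, constC, ← Real.rpow_mul (by positivity)]
    norm_num
  set C := constC ℓ μ ρ Δ
  set M := √(L2 ℓ μ ρ)
  set L := L1 ℓ μ
  have hc2 : √C ^ 2 = C := Real.sq_sqrt hC0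
  have hc0 : 0 ≤ √C := Real.sqrt_nonneg _
  set c := √C
  set a := L / (4 * M) with ha
  have ha0 : 0 ≤ a := by positivity
  have hL : L = 4 * M * a := by rw [ha]; field_simp
  -- C is defined so that C√C = 128 M Δ; this makes 2LΔ equal to a C c/16, far below the cross term
  -- 2 a c C.
  have key : b ^ 2 ≤ (a * c + C) ^ 2 := by
    have e : 2 * L * Δ = a * (C * c) / 16 := by rw [hC, hL]; ring
    have : 0 ≤ a * (C * c) := by positivity
    nlinarith [sq_nonneg (a * c - C)]
  have := le_of_sq_le_sq key (by positivity)
  linarith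

/-- κ ≥ 1 gives 1 + κ ≤ 2κ, hence L₂ ≤ 8ρκ³. -/
theorem sqrt_L2_le (hℓ : 0 < ℓ) (hμ : 0 < μ) (hρ : 0 < ρ) (hμℓ : μ ≤ ℓ) :
    √(L2 ℓ μ ρ) ≤ 2 * √2 * (ρ ^ (1 / 2 : ℝ) * kappa ℓ μ ^ (3 / 2 : ℝ)) := by
  have hκ := kappa_pos hℓ hμ
  have hκ1 := one_le_kappa hμ hμℓ
  rw [rpow_three_halves hκ.le, ← Real.sqrt_eq_rpow, Real.sqrt_le_left (by positivity), L2]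
  have e : (2 * √2 * (√ρ * (kappa ℓ μ * √(kappa ℓ μ)))) ^ 2 = ρ * (2 * kappa ℓ μ) ^ 3 := by
    simp only [mul_pow, Real.sq_sqrt hρ.le, Real.sq_sqrt hκ.le, Real.sq_sqrt zero_le_two]
    ring
  rw [e]
  gcongr
  linarith

theorem iteration_bound_le (hℓ : 0 < ℓ) (hμ : 0 < μ) (hρ : 0 < ρ) (hμℓ : μ ≤ ℓ) (hΔ : 0 ≤ Δ)
    (hε : 0 < ε) (hε1 : ε ≤ 1) :
    128 * logFactor ℓ μ ρ Δ ε * √(L2 ℓ μ ρ) * Δ * ε ^ (-(3 / 2) : ℝ) + 1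
      ≤ 256 * √2 * logFactor ℓ μ ρ Δ ε *
        (ρ ^ (1 / 2 : ℝ) * kappa ℓ μ ^ (3 / 2 : ℝ) * ε ^ (-(3 / 2) : ℝ)) * Δ + 1 := by
  have hF : 0 ≤ logFactor ℓ μ ρ Δ ε := by
    rw [logFactor_eq hℓ hμ hε hε1]; positivity
  calc _ ≤ 128 * logFactor ℓ μ ρ Δ ε * (2 * √2 * (ρ ^ (1 / 2 : ℝ) * kappa ℓ μ ^ (3 / 2 : ℝ)))
        * Δ * ε ^ (-(3 / 2) : ℝ) + 1 := by
        gcongr; exact sqrt_L2_le hℓ hμ hρ hμℓ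
    _ = _ := by ring

/-- Threshold below which the explicit stationarity constants are valid. -/
noncomputable def epsThreshold (M Δ : ℝ) : ℝ :=
  if 0 < Δ then min (1 / 4) ((128 * M * Δ / 7) ^ (2 / 3 : ℝ)) else 1

theorem epsThreshold_pos {M : ℝ} (hM : 0 < M) : 0 < epsThreshold M Δ := by
  unfold epsThreshold
  split_ifs with h
  · exact lt_min (by norm_num) (by positivity)
  · exact one_pos

theorem seven_mul_le_of_le_epsThreshold {M : ℝ} (hM : 0 < M) (hΔ : 0 < Δ) (hε : 0 < ε)
    (h : ε ≤ epsThreshold M Δ) : ε ≤ 1 / 4 ∧ 7 * (ε * √ε) ≤ 128 * M * Δ := by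
  rw [epsThreshold, if_pos hΔ] at h
  refine ⟨h.trans (min_le_left _ _), ?_⟩
  have h1 := Real.rpow_le_rpow hε.le (h.trans (min_le_right _ _)) (by norm_num : 0 ≤ (3 / 2 : ℝ))
  rw [← Real.rpow_mul (by positivity), rpow_three_halves hε.le] at h1
  norm_num at h1
  linarith

end Constants

/-! ### Runs of the algorithm and the iteration bound. -/

section Run

variable {n m : ℕ} {f : Rn n → Rn m → ℝ} {ℓ μ ρ Pstar ε Δ : ℝ} {N : ℕ → ℕ} {x₀ : Rn n} {y₀ : Rn m}
  {x : ℕ → Rn n} {y : ℕ → Rn m} {s : ℕ → Rn n}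

local notation "⟪" x ", " y "⟫" => inner ℝ x y

/-- Moving x by s_t shifts the maximizer by at most κ‖s_t‖, so the warm start lies within A + κ‖s_t‖
of the new one: the numerator in the prescribed logarithm. -/
theorem norm_sub_yStar_le_accA (hℓ : 0 < ℓ) (hμ : 0 < μ) (hρ : 0 < ρ) (hμℓ : μ ≤ ℓ)
    (hA : Assumptions f ℓ μ ρ Pstar) (hε : 0 < ε)
    (hrun : IsRun f (2 / (ℓ + μ)) (√(L2 ℓ μ ρ) / 2) (1 / (4 * √(L2 ℓ μ ρ))) ε N x₀ y₀ x y s)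
    (hN : EnoughInnerSteps f (kappa ℓ μ) (accA ℓ μ ρ ε) x₀ y₀ s N) {t : ℕ} (ht : 1 ≤ t) :
    ‖y t - yStar f (x t)‖ ≤ accA ℓ μ ρ ε := by
  have ha := accA_pos hℓ hμ hρ hε
  induction t, ht using Nat.le_induction with
  | base =>
    rw [hrun.ascent 1 le_rfl]
    refine hA.norm_ascent_iterate_sub_le_of_log_le hℓ hμ hμℓ ha le_rfl ?_
    rw [Nat.sub_self, hrun.init_x, hrun.init_y]
    exact hN.1
  | succ t ht ih =>
    rw [hrun.ascent (t + 1) (by omega)]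
    refine hA.norm_ascent_iterate_sub_le_of_log_le hℓ hμ hμℓ ha ?_ (hN.2 (t + 1) (by omega))
    rw [Nat.add_sub_cancel]
    have h1 := hA.yStar_lipschitz hμ (x t) (x (t + 1))
    rw [hrun.update t ht, sub_add_cancel_left, norm_neg, ← hrun.update t ht] at h1
    calc _ ≤ ‖y t - yStar f (x t)‖ + ‖yStar f (x t) - yStar f (x (t + 1))‖ :=
          norm_sub_le_norm_sub_add_norm_sub _ _ _
      _ ≤ _ := add_le_add ih h1

theorem inexactStep_of_isRun (hℓ : 0 < ℓ) (hμ : 0 < μ) (hρ : 0 < ρ) (hμℓ : μ ≤ ℓ)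
    (hA : Assumptions f ℓ μ ρ Pstar) (hε : 0 < ε)
    (hrun : IsRun f (2 / (ℓ + μ)) (√(L2 ℓ μ ρ) / 2) (1 / (4 * √(L2 ℓ μ ρ))) ε N x₀ y₀ x y s)
    (hN : EnoughInnerSteps f (kappa ℓ μ) (accA ℓ μ ρ ε) x₀ y₀ s N) {t : ℕ} (ht : 1 ≤ t) :
    InexactStep (fun x => gradX f x (yStar f x)) (fun x => schurH f x (yStar f x))
      (√(L2 ℓ μ ρ)) (L1 ℓ μ) ε (x t) (gradX f (x t) (y t)) (schurH f (x t) (y t)) (s t) := by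
  have hy := norm_sub_yStar_le_accA hℓ hμ hρ hμℓ hA hε hrun hN ht
  have hH := LH_pos hℓ hμ hρ
  have hL := L1_pos hℓ hμ
  have hg : ‖gradX f (x t) (y t) - gradX f (x t) (yStar f (x t))‖ ≤ eps1 ℓ μ ρ ε := by
    refine (hA.gradX_lipschitz _ _ _ _).trans ?_
    rw [sub_self, pairNorm_zero_left]
    exact (mul_le_mul_of_nonneg_left hy hℓ.le).trans (mul_accA_le_eps1 hℓ)
  refine ⟨hg.trans (eps1_le hε), (mul_le_mul_of_nonneg_left hg hL.le).trans
    (L1_mul_eps1_le hℓ hμ hε), ?_, hA.schurH_symm hμ _ _, hA.norm_schurH_le hℓ hμ _ _,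
    hrun.feasible t ht, hrun.optimal t ht⟩
  refine (hA.schurH_lipschitz hℓ hμ hρ _ _ _ _).trans ?_
  rw [sub_self, pairNorm_zero_left]
  refine ((mul_le_mul_of_nonneg_left hy hH.le).trans (mul_accA_le_eps2 hH)).trans_eq ?_
  rw [eps2]
  ring

theorem sq_norm_gradX_yStar_le (hℓ : 0 < ℓ) (hμ : 0 < μ) (hA : Assumptions f ℓ μ ρ Pstar)
    (x : Rn n) : ‖gradX f x (yStar f x)‖ ^ 2 ≤ 2 * L1 ℓ μ * (primal f x - Pstar) :=
  norm_grad_sq_le (hA.hasFDerivAt_primal hℓ hμ) (L1_pos hℓ hμ) (hA.gradX_yStar_lipschitz hℓ hμ)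
    hA.lower_bound x

/-- While no iterate is stationary, the number of iterations stays below the claimed bound. -/
theorem natCast_le_of_forall_not_isSOSP (hℓ : 0 < ℓ) (hμ : 0 < μ) (hρ : 0 < ρ) (hμℓ : μ ≤ ℓ)
    (hA : Assumptions f ℓ μ ρ Pstar) (hΔ : primal f x₀ - Pstar = Δ) (hΔ0 : 0 < Δ) (hε : 0 < ε)
    (hεb : ε ≤ epsThreshold (√(L2 ℓ μ ρ)) Δ)
    (hrun : IsRun f (2 / (ℓ + μ)) (√(L2 ℓ μ ρ) / 2) (1 / (4 * √(L2 ℓ μ ρ))) ε N x₀ y₀ x y s)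
    (hN : EnoughInnerSteps f (kappa ℓ μ) (accA ℓ μ ρ ε) x₀ y₀ s N) {k : ℕ}
    (hk : ∀ t, 1 ≤ t → t ≤ k →
      ¬ IsSOSP (primal f) (97 / 96) (19 / 12 * √(L2 ℓ μ ρ)) ε (x t)) :
    (k : ℝ) ≤ 128 * logFactor ℓ μ ρ Δ ε * √(L2 ℓ μ ρ) * Δ * ε ^ (-(3 / 2) : ℝ) := by
  have hM2 : √(L2 ℓ μ ρ) ^ 2 = L2 ℓ μ ρ := Real.sq_sqrt (L2_pos hℓ hμ hρ).le
  have hM := Real.sqrt_pos.2 (L2_pos hℓ hμ hρ)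
  obtain ⟨hε4, hε7⟩ := seven_mul_le_of_le_epsThreshold hM hΔ0 hε hεb
  have hε1 : ε ≤ 1 := hε4.trans (by norm_num)
  have hL := L1_pos hℓ hμ
  have hq1 : √ε ≤ 1 := Real.sqrt_le_one.2 hε1
  have hqpos : 0 < ε * √ε := mul_pos hε (Real.sqrt_pos.2 hε)
  have hqle : ε * √ε ≤ ε := mul_le_of_le_one_right hε.le hq1
  have hstep := fun t (ht : 1 ≤ t) => inexactStep_of_isRun hℓ hμ hρ hμℓ hA hε hrun hN ht
  have hx1 : primal f (x 1) - Pstar = Δ := by rw [hrun.init_x, hΔ]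
  obtain ⟨K, j, h1, h2, h3, -⟩ := exists_count (p := fun t => primal f (x t) - Pstar)
    (γ := fun t => ‖gradX f (x t) (y t)‖) (d := 7 / 6 * (ε * √ε) / (128 * √(L2 ℓ μ ρ)))
    (ε := ε) (Γ := constG ℓ μ ρ Δ)
    (F := ⌈Real.log (constG ℓ μ ρ Δ / ε) / Real.log 3⌉₊) (N := k) (by positivity)
    (fun t ht htk => by
      have hns := hk t ht htk
      rw [hA.isSOSP_iff hℓ hμ] at hns
      have h := (hstep t ht).decrease_or_shrink (hA.hasFDerivAt_primal hℓ hμ)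
        (hA.hasFDerivAt_gradX_yStar hℓ hμ)
        (fun x x' => by rw [hM2]; exact hA.schurH_yStar_lipschitz hℓ hμ hρ x x') hM hL hε hε4 hns
      simp only [← hrun.update t ht] at h
      rcases h with h | ⟨h4, h5, h6⟩
      · left; linarith
      · refine Or.inr ⟨by linarith, h5, ?_⟩
        -- The new inexact gradient is at most 18/96 ‖g_t‖ plus the error ε√ε/96, hence at most
        -- 19/96 ‖g_t‖, below a third.
        have h7 := (hstep (t + 1) (by omega)).grad_err
        have h8 := norm_le_norm_add_norm_sub' (gradX f (x (t + 1)) (y (t + 1)))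
          (gradX f (x (t + 1)) (yStar f (x (t + 1))))
        linarith)
    (fun t ht hpt => by
      have h7 := (hstep t ht).grad_err
      have h8 := norm_le_norm_add_norm_sub' (gradX f (x t) (y t)) (gradX f (x t) (yStar f (x t)))
      have h9 := le_constG_of_sq_le (ρ := ρ) hℓ hμ hρ hΔ0.le
        ((sq_norm_gradX_yStar_le hℓ hμ hA (x t)).trans
          (mul_le_mul_of_nonneg_left (hpt.trans_eq hx1) (by positivity)))
      linarith)
    (fun j hj => add_one_le_ceil_log hε j hj)
  rw [logFactor_eq hℓ hμ hε hε1, rpow_neg_three_halves hε.le]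
  set F := ⌈Real.log (constG ℓ μ ρ Δ / ε) / Real.log 3⌉₊
  set M := √(L2 ℓ μ ρ)
  have hlow := hA.lower_bound (x (k + 1))
  rw [hx1] at h3
  have hKd : K * (7 / 6 * (ε * √ε) / (128 * M)) ≤ Δ := by linarith
  set X := 128 * M * Δ * (ε * √ε)⁻¹ with hX
  have hX7 : 7 ≤ X := by
    rw [hX, ← div_eq_mul_inv, le_div_iff₀ hqpos]; exact hε7
  have hK : (K : ℝ) * (7 / 6) ≤ X := by
    rw [hX, ← div_eq_mul_inv, le_div_iff₀ hqpos]
    rw [mul_div_assoc', div_le_iff₀ (by positivity)] at hKd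
    linarith
  -- The unfinished block j ≤ F is rounded up to a full one; K ≤ 6X/7 and 1 ≤ X/7 then give K + 1 ≤
  -- X.
  have hkn : k ≤ (F + 1) * (K + 1) := by
    have : (F + 1) * (K + 1) = (F + 1) * K + F + 1 := by ring
    omega
  calc (k : ℝ) ≤ ((F + 1) * (K + 1) : ℕ) := by exact_mod_cast hkn
    _ = ((F : ℝ) + 1) * (K + 1) := by push_cast; ring
    _ ≤ ((F : ℝ) + 1) * X := by gcongr; linarith
    _ = _ := by rw [hX]; ring

theorem exists_isFirstIndex_of_isSOSP {P : Rn n → ℝ} {ξ θ : ℝ} {t : ℕ} (ht : 1 ≤ t)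
    (h : IsSOSP P ξ θ ε (x t)) : ∃ T, IsFirstIndex P x ξ θ ε T ∧ T ≤ t :=
  ⟨_, ⟨Nat.sInf_mem (s := {t | 1 ≤ t ∧ IsSOSP P ξ θ ε (x t)}) ⟨t, ht, h⟩,
    fun _ ha => Nat.sInf_le ha⟩, Nat.sInf_le ⟨ht, h⟩⟩

theorem exists_isFirstIndex_explicit (hℓ : 0 < ℓ) (hμ : 0 < μ) (hρ : 0 < ρ) (hμℓ : μ ≤ ℓ)
    (hA : Assumptions f ℓ μ ρ Pstar) (hΔ : primal f x₀ - Pstar = Δ) (hε : 0 < ε)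
    (hεb : ε ≤ epsThreshold (√(L2 ℓ μ ρ)) Δ)
    (hrun : IsRun f (2 / (ℓ + μ)) (√(L2 ℓ μ ρ) / 2) (1 / (4 * √(L2 ℓ μ ρ))) ε N x₀ y₀ x y s)
    (hN : EnoughInnerSteps f (kappa ℓ μ) (accA ℓ μ ρ ε) x₀ y₀ s N) :
    ∃ T : ℕ, IsFirstIndex (primal f) x (97 / 96) (19 / 12 * √(L2 ℓ μ ρ)) ε T ∧
      (T : ℝ) ≤ 128 * logFactor ℓ μ ρ Δ ε * √(L2 ℓ μ ρ) * Δ * ε ^ (-(3 / 2) : ℝ) + 1 := by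
  have hlow := hA.lower_bound x₀
  rcases (show 0 ≤ Δ by linarith).eq_or_lt with h0 | hpos
  -- Δ = 0: x₀ is a global minimizer of P, so the first iterate is stationary and T = 1.
  · have hmin : ∀ z, primal f x₀ ≤ primal f z := fun z => by
      have := hA.lower_bound z
      linarith
    have hg : gradX f x₀ (yStar f x₀) = 0 := by
      have h := sq_norm_gradX_yStar_le hℓ hμ hA x₀
      rw [hΔ, ← h0, mul_zero] at h
      exact norm_eq_zero.1 (pow_eq_zero_iff two_ne_zero |>.1 (le_antisymm h (sq_nonneg _)))
    have hS : IsSOSP (primal f) (97 / 96) (19 / 12 * √(L2 ℓ μ ρ)) ε (x 1) := by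
      rw [hrun.init_x, hA.isSOSP_iff hℓ hμ, hg, norm_zero]
      refine ⟨by positivity, fun v => le_trans ?_ (hessian_nonneg_of_min
        (hA.hasFDerivAt_primal hℓ hμ) (hA.hasFDerivAt_gradX_yStar hℓ hμ)
        (hA.schurH_yStar_lipschitz hℓ hμ hρ) hmin hg v)⟩
      have : 0 ≤ 19 / 12 * √(L2 ℓ μ ρ) * √ε * ‖v‖ ^ 2 := by positivity
      linarith
    obtain ⟨T, hT, hT1⟩ := exists_isFirstIndex_of_isSOSP le_rfl hS
    refine ⟨T, hT, ?_⟩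
    rw [← h0]
    simpa using hT1
  · have hbound := fun k => natCast_le_of_forall_not_isSOSP (k := k) hℓ hμ hρ hμℓ hA hΔ hpos hε hεb
      hrun hN
    have hex : ∃ t, 1 ≤ t ∧ IsSOSP (primal f) (97 / 96) (19 / 12 * √(L2 ℓ μ ρ)) ε (x t) := by
      by_contra hno
      push Not at hno
      obtain ⟨k, hk⟩ := exists_nat_gt
        (128 * logFactor ℓ μ ρ Δ ε * √(L2 ℓ μ ρ) * Δ * ε ^ (-(3 / 2) : ℝ))
      exact absurd (hbound k fun t ht _ => hno t ht) (not_le.2 hk)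
    obtain ⟨t, ht, hS⟩ := hex
    obtain ⟨T, hT, -⟩ := exists_isFirstIndex_of_isSOSP ht hS
    refine ⟨T, hT, ?_⟩
    have h1 : 1 ≤ T := hT.1.1
    -- Only the T - 1 iterates before T are non-stationary, which accounts for the final +1.
    have h2 := hbound (T - 1) fun t ht htT hS => by
      have := hT.2 ⟨ht, hS⟩
      omega
    rw [Nat.cast_sub h1, Nat.cast_one] at h2
    linarith

end Run

end GRTR

/-! ### Choice of ξ, θ and the threshold. -/

open GRTR in
theorem theorem1 (ℓ μ ρ Δ : ℝ) (hℓ : 0 < ℓ) (hμ : 0 < μ) (hρ : 0 < ρ) :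
    ∃ ξ θ εbar : ℝ, 0 < ξ ∧ 0 < θ ∧ 0 < εbar ∧
      ∀ (n m : ℕ) (_ : 0 < m) (f : Rn n → Rn m → ℝ) (Pstar : ℝ)
        (_ : Assumptions f ℓ μ ρ Pstar)
        (x₀ : Rn n) (y₀ : Rn m) (_ : primal f x₀ - Pstar = Δ)
        (ε : ℝ) (_ : 0 < ε) (_ : ε ≤ 1)
        (N : ℕ → ℕ) (x : ℕ → Rn n) (y : ℕ → Rn m) (s : ℕ → Rn n)
        (_ : IsRun f (2 / (ℓ + μ)) (√(L2 ℓ μ ρ) / 2) (1 / (4 * √(L2 ℓ μ ρ))) ε N x₀ y₀ x y s)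
        (_ : EnoughInnerSteps f (kappa ℓ μ) (accA ℓ μ ρ ε) x₀ y₀ s N),
        (∃ T : ℕ, IsFirstIndex (primal f) x ξ θ ε T ∧
          (T : ℝ) ≤ 128 * logFactor ℓ μ ρ Δ ε * √(L2 ℓ μ ρ) * Δ * ε ^ (-(3 / 2) : ℝ) + 1 ∧
          (T : ℝ) ≤ 256 * √2 * logFactor ℓ μ ρ Δ ε *
            (ρ ^ (1 / 2 : ℝ) * kappa ℓ μ ^ (3 / 2 : ℝ) * ε ^ (-(3 / 2) : ℝ)) * Δ + 1) ∧
        (ε ≤ εbar →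
          ∃ T : ℕ, IsFirstIndex (primal f) x (97 / 96) (19 / 12 * √(L2 ℓ μ ρ)) ε T ∧
          (T : ℝ) ≤ 128 * logFactor ℓ μ ρ Δ ε * √(L2 ℓ μ ρ) * Δ * ε ^ (-(3 / 2) : ℝ) + 1 ∧
          (T : ℝ) ≤ 256 * √2 * logFactor ℓ μ ρ Δ ε *
            (ρ ^ (1 / 2 : ℝ) * kappa ℓ μ ^ (3 / 2 : ℝ) * ε ^ (-(3 / 2) : ℝ)) * Δ + 1) := by
  have hM := Real.sqrt_pos.2 (L2_pos hℓ hμ hρ)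
  have hL := L1_pos hℓ hμ
  have hb : 0 < epsThreshold (√(L2 ℓ μ ρ)) Δ := epsThreshold_pos hM
  set b := epsThreshold (√(L2 ℓ μ ρ)) Δ with hbdef
  -- The added terms are global bounds divided by the threshold: ‖∇P(x₀)‖ ≤ √(2L₁Δ) over b, and
  -- ‖∇²P(x₀)‖ ≤ L₁ over √b.
  refine ⟨97 / 96 + √(2 * L1 ℓ μ * Δ) / b, 19 / 12 * √(L2 ℓ μ ρ) + L1 ℓ μ / √b, b,
    by positivity, by positivity, hb, ?_⟩
  intro n m hm f Pstar hA x₀ y₀ hΔ ε hε hε1 N x y s hrun hN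
  have hμℓ := hA.mu_le hℓ hm
  have hΔ0 : 0 ≤ Δ := by have := hA.lower_bound x₀; linarith
  have hle := iteration_bound_le (Δ := Δ) hℓ hμ hρ hμℓ hΔ0 hε hε1
  have hexpl := fun h => exists_isFirstIndex_explicit hℓ hμ hρ hμℓ hA hΔ hε h hrun hN
  refine ⟨?_, fun h => ?_⟩
  · suffices h : ∃ T : ℕ, IsFirstIndex (primal f) x (97 / 96 + √(2 * L1 ℓ μ * Δ) / b)
        (19 / 12 * √(L2 ℓ μ ρ) + L1 ℓ μ / √b) ε T ∧
        (T : ℝ) ≤ 128 * logFactor ℓ μ ρ Δ ε * √(L2 ℓ μ ρ) * Δ * ε ^ (-(3 / 2) : ℝ) + 1 by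
      obtain ⟨T, hT, hT1⟩ := h
      exact ⟨T, hT, hT1, hT1.trans hle⟩
    rcases le_or_gt ε b with hεb | hεb
    · obtain ⟨T', hT', hT'1⟩ := hexpl hεb
      obtain ⟨hge, hS⟩ := hT'.1
      rw [hA.isSOSP_iff hℓ hμ] at hS
      obtain ⟨T, hT, hTT⟩ := exists_isFirstIndex_of_isSOSP (P := primal f) (x := x) (ε := ε)
        (ξ := 97 / 96 + √(2 * L1 ℓ μ * Δ) / b) (θ := 19 / 12 * √(L2 ℓ μ ρ) + L1 ℓ μ / √b) hge (by
          rw [hA.isSOSP_iff hℓ hμ]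
          refine ⟨hS.1.trans ?_, fun v => le_trans ?_ (hS.2 v)⟩
          · gcongr
            exact le_add_of_nonneg_right (by positivity)
          · gcongr
            exact le_add_of_nonneg_right (by positivity))
      exact ⟨T, hT, le_trans (by exact_mod_cast hTT) hT'1⟩
    -- Above the threshold ε/b > 1, so the enlarged tolerances already accept x₁ = x₀.
    · obtain ⟨T, hT, hTT⟩ := exists_isFirstIndex_of_isSOSP (P := primal f) (x := x) (ε := ε)
        (ξ := 97 / 96 + √(2 * L1 ℓ μ * Δ) / b) (θ := 19 / 12 * √(L2 ℓ μ ρ) + L1 ℓ μ / √b)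
        le_rfl (by
          rw [hA.isSOSP_iff hℓ hμ, hrun.init_x]
          constructor
          · have h1 := sq_norm_gradX_yStar_le hℓ hμ hA x₀
            rw [hΔ] at h1
            have h2 := Real.le_sqrt_of_sq_le h1
            have h3 : √(2 * L1 ℓ μ * Δ) ≤ √(2 * L1 ℓ μ * Δ) / b * ε := by
              rw [div_mul_eq_mul_div, le_div_iff₀ hb]
              gcongr
            linarith
          · intro v
            have h1 := (abs_le.1 (abs_real_inner_le_norm v (schurH f x₀ (yStar f x₀) v))).1
            have h2 := (schurH f x₀ (yStar f x₀)).le_of_opNorm_le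
              (hA.norm_schurH_le hℓ hμ x₀ _) v
            have h3 : ‖v‖ * ‖schurH f x₀ (yStar f x₀) v‖ ≤ ‖v‖ * (L1 ℓ μ * ‖v‖) := by gcongr
            have h4 : L1 ℓ μ ≤ (19 / 12 * √(L2 ℓ μ ρ) + L1 ℓ μ / √b) * √ε := by
              have h5 : L1 ℓ μ ≤ L1 ℓ μ / √b * √ε := by
                rw [div_mul_eq_mul_div, le_div_iff₀ (by positivity)]
                gcongr
              have h6 : 0 ≤ 19 / 12 * √(L2 ℓ μ ρ) * √ε := by positivity
              linarith
            have h7 : L1 ℓ μ * ‖v‖ ^ 2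
                ≤ (19 / 12 * √(L2 ℓ μ ρ) + L1 ℓ μ / √b) * √ε * ‖v‖ ^ 2 := by gcongr
            linarith)
      refine ⟨T, hT, ?_⟩
      have hF : 0 ≤ logFactor ℓ μ ρ Δ ε := by
        rw [logFactor_eq hℓ hμ hε hε1]; positivity
      have hT1 : (T : ℝ) ≤ 1 := by exact_mod_cast hTT
      have : 0 ≤ 128 * logFactor ℓ μ ρ Δ ε * √(L2 ℓ μ ρ) * Δ * ε ^ (-(3 / 2) : ℝ) := by positivity
      linarith
  · obtain ⟨T, hT, hT1⟩ := hexpl h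
    exact ⟨T, hT, hT1, hT1.trans hle⟩
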